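/- Let $\mathbb F_q$ be a finite field with $q$ elements, of characteristic $p$, let $k=\mathbb F_q(\theta)$, $k_\infty=\mathbb F_q((1/\theta))$, let $\mathbb C_\infty$ be the completion of an algebraic closure of $k_\infty$, with the valuation $v_\infty$ normalized by $v_\infty(\theta)=-1$, and let $\overline k$ and $\overline{\mathbb F_q}$ be the algebraic closures of $k$ and $\mathbb F_q$ in $\mathbb C_\infty$. Fix $\tilde\theta\in\mathbb C_\infty$ with $\tilde\theta^{\,q-1}=-\theta$. Let $n\ge 0$, let $u_1,\dots,u_n\in\overline k$ satisfy $v_\infty(u_i)>-\frac{q}{q-1}$, put $K=k(\tilde\theta,u_1,\dots,u_n)$, and let $u\in K$ be a uniformizer of the discrete valuation ring $\{x\in K: v_\infty(x)\ge 0\}$. Let $d\ge1$ and let $\mathbf l,\mathbf l_1,\dots,\mathbf l_n\in\mathbb F_{q^d}[[Z]]$ be the power series with $$\mathbf l(u)=\frac1\theta,\qquad \mathbf l_i(u)=\frac{u_i}{\theta\tilde\theta}\quad(1\le i\le n)$$ (they exist, and are unique, when $\mathbb F_{q^d}$ is the residue field of the completion $K_\infty=k_\infty K$ of $K$). Let $\beta\in\overline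 k\setminus\{0\}$, let $s\ge1$ be an integer, and define the formal power series $$\pi_m(Z)=\beta^{-m}\prod_{i=1}^{m}\bigl(1-\theta\,\mathbf l(Z)^{q^i}\bigr)^s,\qquad G_0(Z)=\prod_{m\ge1}\bigl(1-\theta\,\mathbf l(Z)^{q^m}\bigr)^{-s},\qquad G_i(Z)=\sum_{m\ge0}\frac{\mathbf l_i(Z)^{q^m}}{\pi_m(Z)}\quad(1\le i\le n).$$ Let $\mathbf B=\bigcup_{h\ge0}\overline{\mathbb F_q}(\theta^{1/p^h},\beta^{1/p^h})$ be the purely inseparable closure of $\overline{\mathbb F_q}(\theta,\beta)$ in $\mathbb C_\infty$. If the family $(G_i(Z))_{i=0}^n$ is algebraically dependent over $k(Z)$, then there exist $\eta_0,\dots,\eta_n\in\mathbf B$, not all zero, such that $\sum_{i=0}^n\eta_iG_i(Z)$ is algebraic over $k(Z)$. -/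

import Mathlib

open scoped NNReal LaurentSeries PowerSeries WithZero

noncomputable section

namespace CarlitzMahler

/-! ### The fields `k_∞`, `ℂ_∞`, `k`, `k̄`, `𝐁`, `k(Z)` -/

section Infinity

variable (Fq : Type*) [Field Fq]

/-- `k_∞ = 𝔽_q((1/θ))`: Laurent series over `𝔽_q` in the variable `1/θ`. -/
def KInf : Type _ := Fq⸨X⸩

instance : Field (KInf Fq) := inferInstanceAs (Field Fq⸨X⸩)
instance : Algebra Fq (KInf Fq) := inferInstanceAs (Algebra Fq Fq⸨X⸩)
instance : Valued (KInf Fq) ℤᵐ⁰ := inferInstanceAs (Valued Fq⸨X⸩ ℤᵐ⁰)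
instance : CompleteSpace (KInf Fq) := inferInstanceAs (CompleteSpace Fq⸨X⸩)

/-- `1/θ`, the variable of the Laurent series field `k_∞`. -/
def invThetaInf : KInf Fq := (HahnSeries.single (1 : ℤ) (1 : Fq) : Fq⸨X⸩)

theorem valued_invThetaInf :
    (Valued.v : Valuation (KInf Fq) ℤᵐ⁰) (invThetaInf Fq) = WithZero.exp (-1 : ℤ) :=
  LaurentSeries.valuation_single_zpow Fq 1

end Infinity

section Fields

variable (Fq : Type*) [Field Fq] [Finite Fq]

/-- `q`, the cardinality of the finite field `𝔽_q`. -/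
abbrev q : ℕ := Nat.card Fq

theorem one_lt_q : (1 : ℝ≥0) < q Fq := by
  exact_mod_cast Finite.one_lt_card (α := Fq)

/-- The valuation of `k_∞` is turned into the absolute value `|x| = q ^ (-v_∞(x))`,
where `v_∞(1/θ) = 1`. -/
instance : (Valued.v : Valuation (KInf Fq) ℤᵐ⁰).RankOne where
  hom' := (WithZeroMulInt.toNNReal (one_pos.trans (one_lt_q Fq)).ne').comp
    MonoidWithZeroHom.ValueGroup₀.embedding
  strictMono' := (WithZeroMulInt.toNNReal_strictMono (one_lt_q Fq)).comp
    MonoidWithZeroHom.ValueGroup₀.embedding_strictMono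
  exists_val_nontrivial := ⟨invThetaInf Fq, by rw [valued_invThetaInf]; simp,
    by rw [valued_invThetaInf]; decide⟩

instance : NontriviallyNormedField (KInf Fq) := Valued.toNontriviallyNormedField (KInf Fq) ℤᵐ⁰

instance : IsUltrametricDist (KInf Fq) := inferInstance

/-- The algebraic closure of `k_∞` carries the unique extension of the absolute value
of `k_∞`. -/
instance : NontriviallyNormedField (AlgebraicClosure (KInf Fq)) :=
  spectralNorm.nontriviallyNormedField (KInf Fq) (AlgebraicClosure (KInf Fq))

instance : UniformContinuousConstSMul Fq (AlgebraicClosure (KInf Fq)) where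
  uniformContinuous_const_smul c := by
    simp only [Algebra.smul_def]
    exact uniformContinuous_const_smul
      (algebraMap Fq (AlgebraicClosure (KInf Fq)) c)

/-- `ℂ_∞`, the completion of an algebraic closure of `k_∞`. Its norm is `‖x‖ = q ^ (-v_∞(x))`. -/
abbrev CInf : Type _ := UniformSpace.Completion (AlgebraicClosure (KInf Fq))

/-- `θ` as an element of `ℂ_∞`. -/
def theta : CInf Fq :=
  ((algebraMap (KInf Fq) (AlgebraicClosure (KInf Fq)) (invThetaInf Fq)⁻¹ :
    AlgebraicClosure (KInf Fq)) : CInf Fq)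

/-- `k = 𝔽_q(θ)`, inside `ℂ_∞`. -/
abbrev k : IntermediateField Fq (CInf Fq) := IntermediateField.adjoin Fq {theta Fq}

/-- `k̄`, the algebraic closure of `k` in `ℂ_∞`. -/
abbrev kBar : IntermediateField (k Fq) (CInf Fq) := algebraicClosure (k Fq) (CInf Fq)

/-- The algebraic closure of `𝔽_q` in `ℂ_∞`. -/
abbrev FqBar : IntermediateField Fq (CInf Fq) := algebraicClosure Fq (CInf Fq)

/-- The field `𝔽̄_q(θ, β)`, inside `ℂ_∞`. -/
abbrev FqBarThetaBeta (β : CInf Fq) : IntermediateField (FqBar Fq) (CInf Fq) :=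
  IntermediateField.adjoin (FqBar Fq) {theta Fq, β}

/-- `𝐁`, the purely inseparable closure of `𝔽̄_q(θ, β)` in `ℂ_∞`, that is,
`⋃ₕ 𝔽̄_q(θ^(1/p^h), β^(1/p^h))`. -/
abbrev B (β : CInf Fq) : IntermediateField (FqBarThetaBeta Fq β) (CInf Fq) :=
  perfectClosure (FqBarThetaBeta Fq β) (CInf Fq)

/-- `k(Z)`, inside the field `ℂ_∞((Z))` of formal Laurent series. -/
abbrev kZ : IntermediateField (k Fq) (CInf Fq)⸨X⸩ :=
  IntermediateField.adjoin (k Fq) {HahnSeries.single (1 : ℤ) (1 : CInf Fq)}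

end Fields

/-! ### The interpolation series -/

section Series

variable {Fq : Type*} [Field Fq] [Finite Fq]

/-- `K = k(θ̃, u₁, …, uₙ)`. -/
abbrev K {n : ℕ} (θt : CInf Fq) (w : Fin n → CInf Fq) : IntermediateField (k Fq) (CInf Fq) :=
  IntermediateField.adjoin (k Fq) (insert θt (Set.range w))

/-- `u` is a uniformizer of the discrete valuation ring `{x ∈ L | v_∞(x) ≥ 0}`: it is a
nonzero element of its maximal ideal, of largest absolute value there. -/
def IsUniformizer (L : IntermediateField (k Fq) (CInf Fq)) (u : CInf Fq) : Prop :=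
  u ∈ L ∧ u ≠ 0 ∧ ‖u‖ < 1 ∧ ∀ x ∈ L, ‖x‖ < 1 → ‖x‖ ≤ ‖u‖

/-- `f ∈ 𝔽_{q^d}[[Z]]` and `f(u) = x`. Here `𝔽_{q^d}` is the subfield of `ℂ_∞` of the
solutions of `c ^ (q ^ d) = c`, and `f(u)` is the sum of a convergent series in `ℂ_∞`. -/
def IsExpansion (d : ℕ) (u : CInf Fq) (f : (CInf Fq)⟦X⟧) (x : CInf Fq) : Prop :=
  (∀ j, PowerSeries.coeff j f ^ (q Fq ^ d) = PowerSeries.coeff j f) ∧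
    HasSum (fun j : ℕ => PowerSeries.coeff j f * u ^ j) x

/-- `π_m(Z) = β^(-m) ∏_{i=1}^m (1 - θ 𝐥(Z)^(q^i))^s`. -/
def piSeries (l : (CInf Fq)⟦X⟧) (β : CInf Fq) (s m : ℕ) : (CInf Fq)⟦X⟧ :=
  PowerSeries.C (β⁻¹ ^ m) *
    ∏ i ∈ Finset.Icc 1 m, (1 - PowerSeries.C (theta Fq) * l ^ (q Fq ^ i)) ^ s

open scoped PowerSeries.WithPiTopology in
/-- `G₀(Z) = ∏_{m ≥ 1} (1 - θ 𝐥(Z)^(q^m))^(-s)`, a convergent product of formal power series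
when `𝐥(0) = 0`. -/
def GZero (l : (CInf Fq)⟦X⟧) (s : ℕ) : (CInf Fq)⟦X⟧ :=
  ∏' m : ℕ, ((1 - PowerSeries.C (theta Fq) * l ^ (q Fq ^ (m + 1)))⁻¹) ^ s

open scoped PowerSeries.WithPiTopology in
/-- `∑_{m ≥ 0} 𝐥ᵢ(Z)^(q^m) / π_m(Z)`, a convergent series of formal power series when
`𝐥(0) = 𝐥ᵢ(0) = 0`. -/
def GLog (l li : (CInf Fq)⟦X⟧) (β : CInf Fq) (s : ℕ) : (CInf Fq)⟦X⟧ :=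
  ∑' m : ℕ, li ^ (q Fq ^ m) * (piSeries l β s m)⁻¹

/-- The family `G₀, G₁, …, Gₙ`, in `ℂ_∞((Z))`. -/
def G {n : ℕ} (l : (CInf Fq)⟦X⟧) (li : Fin n → (CInf Fq)⟦X⟧) (β : CInf Fq) (s : ℕ) :
    Fin (n + 1) → (CInf Fq)⸨X⸩ :=
  Fin.cons (HahnSeries.ofPowerSeries ℤ (CInf Fq) (GZero l s)) fun i => HahnSeries.ofPowerSeries ℤ (CInf Fq) (GLog l (li i) β s)

end Series

end CarlitzMahler

end

open scoped NNReal LaurentSeries PowerSeries WithZero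

namespace CarlitzMahler

/-! ### Semilinear affine substitutions in polynomials -/

section AffineSubst

open MvPolynomial

variable {ι E : Type*} [Field E]

/-! Put N = q^d and let σ be the Mahler operator f(Z) ↦ f(Z^N). Since the coefficients of 𝐥 and 𝐥ᵢ
are fixed by x ↦ x^N, σ acts on these series as the N-th power. Shifting indices by d in the product
and the sums then gives σG₀ = β^d π_d G₀ and σGᵢ = π_d Gᵢ + bᵢ (`expand_GZero`, `expand_GLog`). Here
π_d and bᵢ are algebraic over k(Z), because 𝐥 and 𝐥ᵢ are: a polynomial relation over 𝔽_q between the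
values 𝐥(u) and u, both in k̄, lifts to one between 𝐥 and Z (`IsExpansion.isAlgebraic`).

The rest is difference algebra over the field E of Laurent series with coefficients in 𝐁 that are
algebraic over k(Z). All the multipliers are the same a = π_d, up to the constant κ = β^d, and a
Laurent series g with σg = const · g is constant (`eq_C_of_mahler_eq`).

A relation among G₀, …, Gₙ over E that is minimal in a suitable sense is an eigenvector of the
substitution X₀ ↦ κaX₀, Xᵢ ↦ aXᵢ + bᵢ (`exists_relation_eigenvector`). Its coefficients R with
respect to X₀ are eigenvectors in X₁, …, Xₙ. If all are constant, G₀ is algebraic over E, and that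
is already a linear relation. Otherwise take a nonconstant R
(`exists_linear_relation_of_eigenvector`). Partial derivatives of R are again eigenvectors, so R can
be lowered until all of them are constant. If they all vanish, R is a polynomial in the Xᵢ^p and one
passes to p-th powers of the Gᵢ; taking p-th roots of constants at the end is why 𝐁 must be perfect.
If one is a nonzero constant, comparing it with a top coefficient of R forces deg R = 1 when G₀ is
transcendental. For such R, R(G) divided by a top coefficient satisfies σy = ay, so it is a constant
multiple of G₀. This is the linear relation. -/

/-- The `σ`-semilinear endomorphism of `E[X_i]` with `X_i ↦ a_i X_i + b_i`. -/
noncomputable def affineSubst (σ : E →+* E) (a b : ι → E) :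
    MvPolynomial ι E →+* MvPolynomial ι E :=
  eval₂Hom (C.comp σ) fun i => C (a i) * X i + C (b i)

@[simp]
theorem affineSubst_C (σ : E →+* E) (a b : ι → E) (c : E) :
    affineSubst σ a b (C c) = C (σ c) := by
  simp [affineSubst]

@[simp]
theorem affineSubst_X (σ : E →+* E) (a b : ι → E) (i : ι) :
    affineSubst σ a b (X i) = C (a i) * X i + C (b i) := by
  simp [affineSubst]

/-- In the expansion of ∏ (a_i X_i + b_i)^(β_i), every choice of a b_i loses a degree. In degrees at
least |β| only the diagonal term survives, so the substitution acts on leading forms by scaling. -/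
theorem coeff_affineSubst_monomial (σ : E →+* E) (a b : ι → E) (β α : ι →₀ ℕ)
    (h : β.degree ≤ α.degree) :
    coeff α (affineSubst σ a b (monomial β 1)) =
      coeff α (monomial β (β.prod fun i k => a i ^ k)) := by
  classical
  induction hN : β.degree generalizing β α with
  | zero =>
    obtain rfl : β = 0 := (Finsupp.degree_eq_zero_iff β).1 hN
    have : (monomial 0 1 : MvPolynomial ι E) = C 1 := rfl
    rw [this, affineSubst_C]
    simp
  | succ N ih =>
    obtain ⟨i, hi⟩ : ∃ i, β i ≠ 0 := by
      by_contra! hcon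
      have : β = 0 := Finsupp.ext hcon
      simp [this] at hN
    obtain ⟨γ, rfl⟩ : ∃ γ, β = γ + Finsupp.single i 1 :=
      ⟨β - Finsupp.single i 1, (tsub_add_cancel_of_le (by
        simpa using Nat.one_le_iff_ne_zero.2 hi)).symm⟩
    have hγ : γ.degree = N := by simpa using hN
    have hprod : ((γ + Finsupp.single i 1).prod fun i k => a i ^ k) =
        (γ.prod fun i k => a i ^ k) * a i := by
      rw [Finsupp.prod_add_index' (by simp) (by intros; rw [pow_add])]
      simp
    have hmul : (monomial (γ + Finsupp.single i 1) 1 : MvPolynomial ι E) =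
        monomial γ 1 * X i := by
      rw [X, monomial_mul, mul_one]
    rw [hmul, map_mul, affineSubst_X, mul_add, coeff_add, mul_left_comm, coeff_C_mul,
      mul_comm _ (C (b i)), coeff_C_mul, coeff_mul_X', ih γ α (by simp at h; lia) hγ, hprod]
    have hne : γ ≠ α := by
      rintro rfl
      simp at h
    rw [coeff_monomial α γ, if_neg hne, mul_zero, add_zero]
    split_ifs with hα
    · obtain ⟨δ, rfl⟩ : ∃ δ, α = δ + Finsupp.single i 1 :=
        ⟨α - Finsupp.single i 1, (tsub_add_cancel_of_le (by
          simpa using Nat.one_le_iff_ne_zero.2 (Finsupp.mem_support_iff.1 hα))).symm⟩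
      rw [add_tsub_cancel_right, ih γ δ (by simpa using h) hγ, coeff_monomial, coeff_monomial]
      simp only [add_left_inj]
      split_ifs <;> simp [mul_comm]
    · rw [coeff_monomial, if_neg, mul_zero]
      rintro rfl
      simp at hα

theorem coeff_affineSubst (σ : E →+* E) (a b : ι → E) (P : MvPolynomial ι E) (α : ι →₀ ℕ)
    (h : P.totalDegree ≤ α.degree) :
    coeff α (affineSubst σ a b P) = σ (coeff α P) * α.prod fun i k => a i ^ k := by
  classical
  conv_lhs => rw [P.as_sum]
  rw [map_sum, coeff_sum]
  have : ∀ β ∈ P.support, coeff α (affineSubst σ a b (monomial β (coeff β P))) =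
      if β = α then σ (coeff α P) * (α.prod fun i k => a i ^ k) else 0 := by
    intro β hβ
    have hm : monomial β (coeff β P) = C (coeff β P) * monomial β 1 := by
      rw [C_mul_monomial, mul_one]
    rw [hm, map_mul, affineSubst_C, coeff_C_mul, coeff_affineSubst_monomial _ _ _ _ _
      ((le_totalDegree hβ).trans h), coeff_monomial]
    split_ifs with h
    · rw [h]
    · simp
  rw [Finset.sum_congr rfl this, Finset.sum_ite_eq']
  split_ifs with h
  · rfl
  · rw [notMem_support_iff.1 h]
    simp

theorem totalDegree_affineSubst_le (σ : E →+* E) (a b : ι → E) (P : MvPolynomial ι E) :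
    (affineSubst σ a b P).totalDegree ≤ P.totalDegree := by
  refine Finset.sup_le fun α hα => ?_
  by_contra! hlt
  have hlt' : P.totalDegree < α.degree := hlt
  refine (mem_support_iff.1 hα) ?_
  rw [coeff_affineSubst _ _ _ _ _ hlt'.le, notMem_support_iff.1, map_zero, zero_mul]
  intro hmem
  exact absurd (le_totalDegree hmem) (not_le.2 hlt)

theorem aeval_affineSubst {Λ : Type*} [Field Λ] [Algebra E Λ] (σE : E →+* E) (σ : Λ →+* Λ)
    (hσ : ∀ x, algebraMap E Λ (σE x) = σ (algebraMap E Λ x)) (a b : ι → E) (x : ι → Λ)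
    (hx : ∀ i, σ (x i) = algebraMap E Λ (a i) * x i + algebraMap E Λ (b i))
    (P : MvPolynomial ι E) :
    aeval x (affineSubst σE a b P) = σ (aeval x P) := by
  have : ((aeval x : MvPolynomial ι E →ₐ[E] Λ) : MvPolynomial ι E →+* Λ).comp
      (affineSubst σE a b) = σ.comp ((aeval x : MvPolynomial ι E →ₐ[E] Λ) : _ →+* Λ) := by
    refine MvPolynomial.ringHom_ext (fun c => ?_) fun i => ?_
    · simp [hσ]
    · simp [hx]
  exact congrArg (fun f : MvPolynomial ι E →+* Λ => f P) this

theorem pderiv_affineSubst (σ : E →+* E) (a b : ι → E) (i : ι) (P : MvPolynomial ι E) :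
    pderiv i (affineSubst σ a b P) = C (a i) * affineSubst σ a b (pderiv i P) := by
  classical
  induction P using MvPolynomial.induction_on with
  | C c => simp
  | add P Q hP hQ => simp only [map_add, hP, hQ, mul_add]
  | mul_X P j h =>
    rw [map_mul, pderiv_mul, h, pderiv_mul, map_add, map_mul, map_mul, affineSubst_X]
    by_cases hij : j = i
    · subst hij
      simp
      ring
    · simp [pderiv_X_of_ne hij]
      ring

/-- Frobenius gives (aX + b)^p = a^p X^p + b^p; coefficients of P are still moved by σ itself. -/
theorem affineSubst_expand (p : ℕ) [ExpChar E p] (σ : E →+* E) (a b : ι → E)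
    (P : MvPolynomial ι E) :
    affineSubst σ a b (expand p P) = expand p (affineSubst σ (a ^ p) (b ^ p) P) := by
  have : (affineSubst σ a b).comp ((expand p : MvPolynomial ι E →ₐ[E] _) : _ →+* _) =
      ((expand p : MvPolynomial ι E →ₐ[E] _) : _ →+* _).comp (affineSubst σ (a ^ p) (b ^ p)) := by
    refine MvPolynomial.ringHom_ext (fun c => ?_) fun i => ?_
    · simp
    · simp [add_pow_expChar, mul_pow]
  exact congrArg (fun f : MvPolynomial ι E →+* _ => f P) this

theorem exists_expand_eq_of_pderiv_eq_zero (p : ℕ) [CharP E p] (P : MvPolynomial ι E)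
    (h : ∀ i, pderiv i P = 0) : ∃ S, expand p S = P := by
  classical
  have hmem : P ∈ (expand p : MvPolynomial ι E →ₐ[E] _).range := by
    rw [P.as_sum]
    refine Subalgebra.sum_mem _ fun α hα => ?_
    have hdvd : ∀ i, p ∣ α i := by
      intro i
      by_cases h0 : α i = 0
      · simp [h0]
      obtain ⟨δ, rfl⟩ : ∃ δ, α = δ + Finsupp.single i 1 :=
        ⟨α - Finsupp.single i 1, (tsub_add_cancel_of_le (by
          simpa using Nat.one_le_iff_ne_zero.2 h0)).symm⟩
      have := coeff_pderiv (i := i) P δ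
      rw [h i, coeff_zero, eq_comm, mul_eq_zero] at this
      have h1 := this.resolve_left (mem_support_iff.1 hα)
      rw [← CharP.cast_eq_zero_iff E p]
      simpa using h1
    refine ⟨monomial (α.mapRange (· / p) (by simp)) (coeff α P), ?_⟩
    have : p • α.mapRange (· / p) (by simp) = α := by
      ext i
      simpa using Nat.mul_div_cancel' (hdvd i)
    change expand p _ = _
    rw [expand_monomial, this]
  exact hmem

theorem totalDegree_pderiv_lt (i : ι) (P : MvPolynomial ι E) (h : P.totalDegree ≠ 0) :
    (pderiv i P).totalDegree < P.totalDegree := by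
  classical
  rw [totalDegree, Finset.sup_lt_iff (Nat.pos_of_ne_zero h)]
  intro α hα
  have h1 : α + Finsupp.single i 1 ∈ P.support := by
    rw [mem_support_iff] at hα ⊢
    intro h0
    rw [coeff_pderiv, h0, zero_mul] at hα
    exact hα rfl
  have h2 : (α + Finsupp.single i 1).degree ≤ _ := le_totalDegree h1
  have h3 : α.degree + 1 ≤ P.totalDegree := by simpa using h2
  exact h3

theorem exists_degree_eq_totalDegree {P : MvPolynomial ι E} (h : P ≠ 0) :
    ∃ α ∈ P.support, α.degree = P.totalDegree := by
  obtain ⟨α, hα, h'⟩ := Finset.exists_mem_eq_sup P.support (support_nonempty.2 h)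
    fun s => s.sum fun _ e => e
  exact ⟨α, hα, h'.symm⟩

/-- A polynomial relation of minimal degree, with the fewest monomials of that degree, is an
eigenvector of a semilinear affine substitution that preserves relations. -/
theorem exists_relation_eigenvector (σ : E →+* E) (a b : ι → E) (I : Ideal (MvPolynomial ι E))
    (hI : ∀ P ∈ I, affineSubst σ a b P ∈ I) (hne : I ≠ ⊥) :
    ∃ P ∈ I, P ≠ 0 ∧ ∃ μ, affineSubst σ a b P = C μ * P := by
  classical
  let top : MvPolynomial ι E → ℕ := fun P =>
    (P.support.filter fun α => α.degree = P.totalDegree).card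
  let S : Set (MvPolynomial ι E) := {P | P ∈ I ∧ P ≠ 0}
  obtain ⟨P₀, hP₀, hP₀'⟩ := Submodule.exists_mem_ne_zero_of_ne_bot hne
  obtain ⟨P, ⟨hPI, hP0⟩, hmin⟩ := WellFounded.has_min
    (InvImage.wf (fun P : MvPolynomial ι E => toLex (P.totalDegree, top P)) wellFounded_lt) S
    ⟨P₀, hP₀, hP₀'⟩
  obtain ⟨α, hα, hdeg⟩ := exists_degree_eq_totalDegree hP0
  -- This μ cancels the top-degree monomial α in R. The monomials of R of that degree all occur in
  -- P, so a nonzero R would be a relation of lower degree or with fewer top monomials.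
  refine ⟨P, hPI, hP0, coeff α (affineSubst σ a b P) / coeff α P, ?_⟩
  set μ := coeff α (affineSubst σ a b P) / coeff α P with hμ
  by_contra hne
  set R := affineSubst σ a b P - C μ * P with hR
  have hR0 : R ≠ 0 := sub_ne_zero.2 hne
  have hRI : R ∈ I := I.sub_mem (hI P hPI) (I.mul_mem_left _ hPI)
  have hRdeg : R.totalDegree ≤ P.totalDegree := by
    refine (totalDegree_sub _ _).trans (max_le (totalDegree_affineSubst_le _ _ _ _) ?_)
    refine (totalDegree_mul _ _).trans ?_
    simp
  refine hmin R ⟨hRI, hR0⟩ ?_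
  change toLex (R.totalDegree, top R) < toLex (P.totalDegree, top P)
  rw [Prod.Lex.toLex_lt_toLex]
  rcases hRdeg.lt_or_eq with h | h
  · exact Or.inl h
  refine Or.inr ⟨h, Finset.card_lt_card ?_⟩
  rw [Finset.ssubset_iff_of_subset]
  · refine ⟨α, by simp [hdeg, mem_support_iff.1 hα], ?_⟩
    have : coeff α R = 0 := by
      rw [hR, coeff_sub, coeff_C_mul, hμ, div_mul_cancel₀ _ (mem_support_iff.1 hα), sub_self]
    simp [this]
  · intro γ hγ
    rw [Finset.mem_filter, mem_support_iff] at hγ ⊢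
    have hγd : γ.degree = P.totalDegree := hγ.2.trans h
    refine ⟨fun h0 => hγ.1 ?_, hγd⟩
    rw [hR, coeff_sub, coeff_C_mul, coeff_affineSubst _ _ _ _ _ hγd.ge, h0]
    simp

/-- Since X₀ ↦ a₀X₀ has no constant term, powers of X₀ do not mix: each coefficient in X₀ is
transformed separately, up to a factor a₀^j. -/
theorem coeff_finSuccEquiv_affineSubst {n : ℕ} (σ : E →+* E) (a₀ : E) (a b : Fin n → E)
    (P : MvPolynomial (Fin (n + 1)) E) (j : ℕ) :
    (finSuccEquiv E n (affineSubst σ (Fin.cons a₀ a) (Fin.cons 0 b) P)).coeff j =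
      affineSubst σ a b ((finSuccEquiv E n P).coeff j) * C a₀ ^ j := by
  have : ((finSuccEquiv E n).toRingEquiv.toRingHom).comp
      (affineSubst σ (Fin.cons a₀ a) (Fin.cons 0 b)) =
      ((Polynomial.compRingHom (Polynomial.C (C a₀) * Polynomial.X)).comp
        (Polynomial.mapRingHom (affineSubst σ a b))).comp
        ((finSuccEquiv E n).toRingEquiv.toRingHom) := by
    refine MvPolynomial.ringHom_ext (fun c => ?_) fun i => ?_
    · simp [finSuccEquiv_apply]
    · refine Fin.cases ?_ (fun i => ?_) i
      · simp [finSuccEquiv_apply]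
      · simp [finSuccEquiv_apply]
  have h2 := congrArg (fun f : MvPolynomial (Fin (n + 1)) E →+* _ => f P) this
  simp only [RingHom.comp_apply] at h2
  have h3 := congrArg (fun f => Polynomial.coeff f j) h2
  refine h3.trans (Polynomial.comp_C_mul_X_coeff.trans ?_)
  rw [Polynomial.coe_mapRingHom, Polynomial.coeff_map]
  rfl

end AffineSubst

end CarlitzMahler

namespace CarlitzMahler

/-! ### Linear relations from algebraic relations -/

section DifferenceFields

open MvPolynomial

variable {E Λ : Type*} [Field E] [Field Λ] [Algebra E Λ]

theorem exists_eq_single_of_degree_eq_one {ι : Type*} {α : ι →₀ ℕ} (h : α.degree = 1) :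
    ∃ i, α = Finsupp.single i 1 := by
  obtain ⟨i, hi⟩ : ∃ i, α i ≠ 0 := by
    by_contra! hcon
    have : α = 0 := Finsupp.ext hcon
    simp [this] at h
  obtain ⟨δ, rfl⟩ : ∃ δ, α = δ + Finsupp.single i 1 :=
    ⟨α - Finsupp.single i 1, (tsub_add_cancel_of_le (by
      simpa using Nat.one_le_iff_ne_zero.2 hi)).symm⟩
  have hδ : δ.degree = 0 := by simpa using h
  exact ⟨i, by rw [(Finsupp.degree_eq_zero_iff δ).1 hδ, zero_add]⟩

theorem aeval_of_totalDegree_le_one {ι : Type*} [Fintype ι] (P : MvPolynomial ι E)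
    (h : P.totalDegree ≤ 1) (x : ι → Λ) :
    aeval x P = algebraMap E Λ (coeff 0 P) +
      ∑ i, algebraMap E Λ (coeff (Finsupp.single i 1) P) * x i := by
  classical
  have hP : P = C (coeff 0 P) + ∑ i, C (coeff (Finsupp.single i 1) P) * X i := by
    ext α
    rw [coeff_add, coeff_sum, coeff_C]
    simp only [coeff_C_mul, coeff_X]
    by_cases hα : α.degree ≤ 1
    · rcases Nat.le_one_iff_eq_zero_or_eq_one.1 hα with h0 | h1
      · obtain rfl := (Finsupp.degree_eq_zero_iff α).1 h0
        simp
      · obtain ⟨i, rfl⟩ := exists_eq_single_of_degree_eq_one h1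
        simp [Finsupp.single_left_inj, eq_comm]
    · rw [notMem_support_iff.1 fun hm => hα ((le_totalDegree hm).trans h), if_neg, zero_add,
        Finset.sum_eq_zero]
      · rintro i -
        rw [if_neg, mul_zero]
        rintro rfl
        simp at hα
      · rintro rfl
        simp at hα
  conv_lhs => rw [hP]
  simp

/-- A field `Λ` with an endomorphism `σ`, extending the endomorphism `σE` of `E`, and a
perfect field `const ⊆ M` of constants that contains all the `σ`-eigenvectors in `M` with
eigenvalue in `const`. -/
structure DifferenceExtension (E Λ : Type*) [Field E] [Field Λ] [Algebra E Λ] (p : ℕ) where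
  σE : E →+* E
  σ : Λ →+* Λ
  M : Subfield Λ
  const : Subfield Λ
  map_algebraMap : ∀ x, σ (algebraMap E Λ x) = algebraMap E Λ (σE x)
  algebraMap_mem : ∀ x, algebraMap E Λ x ∈ M
  isAlgebraic : ∀ c ∈ const, IsAlgebraic E c
  const_of_eigenvector : ∀ κ ∈ const, ∀ g ∈ M, σ g = κ * g → g ∈ const
  perfect : ∀ c ∈ const, ∃ γ ∈ const, γ ^ p = c

namespace DifferenceExtension

variable {p : ℕ} (S : DifferenceExtension E Λ p)

/-- The powers of a cancel in σ(y / G₀^m), which leaves the constant eigenvalue κ^(-m). -/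
theorem div_pow_mem_const {κ G₀ y : Λ} {a : E} {m : ℕ} (hκ : κ ∈ S.const) (ha : a ≠ 0)
    (hG₀ : G₀ ∈ S.M) (h : S.σ G₀ = κ * algebraMap E Λ a * G₀)
    (hy : y ∈ S.M) (hσy : S.σ y = algebraMap E Λ a ^ m * y) : y / G₀ ^ m ∈ S.const := by
  refine S.const_of_eigenvector (κ⁻¹ ^ m) (pow_mem (inv_mem hκ) m) _
    (div_mem hy (pow_mem hG₀ m)) ?_
  have ha' : algebraMap E Λ a ≠ 0 := by simpa using ha
  rw [map_div₀, map_pow, h, hσy, mul_pow, mul_pow]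
  rw [mul_right_comm, mul_comm (κ ^ m * G₀ ^ m), mul_div_mul_left _ _ (pow_ne_zero m ha'),
    inv_pow, div_mul_eq_div_div, div_eq_inv_mul y (κ ^ m), mul_div_assoc]

theorem exists_linear_relation_of_eigenvector [hp : Fact p.Prime] [CharP E p] {n : ℕ}
    (R : MvPolynomial (Fin n) E) (hR : R.totalDegree ≠ 0)
    {κ G₀ : Λ} {a : E} {b : Fin n → E} {G : Fin n → Λ} {μ : E}
    (hκ : κ ∈ S.const) (ha : a ≠ 0) (hG₀M : G₀ ∈ S.M) (hGM : ∀ i, G i ∈ S.M)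
    (hG₀ : S.σ G₀ = κ * algebraMap E Λ a * G₀)
    (hG : ∀ i, S.σ (G i) = algebraMap E Λ a * G i + algebraMap E Λ (b i))
    (htr : Transcendental E G₀)
    (hμ : affineSubst S.σE (fun _ => a) b R = C μ * R) :
    ∃ c₀ ∈ S.const, ∃ c : Fin n → Λ, (∀ i, c i ∈ S.const) ∧ c ≠ 0 ∧
      IsAlgebraic E (c₀ * G₀ + ∑ i, c i * G i) := by
  have : CharP Λ p := charP_of_injective_algebraMap (algebraMap E Λ).injective p
  have : ExpChar E p := ExpChar.prime hp.out
  have : ExpChar Λ p := ExpChar.prime hp.out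
  -- All the data are generalized because the passage to p-th powers below changes κ, a, b and the
  -- series as well as R.
  induction hD : R.totalDegree using Nat.strong_induction_on generalizing R κ G₀ a b G μ with
  | _ D ih =>
  subst hD
  by_cases hex : ∃ i, (pderiv i R).totalDegree ≠ 0
  · obtain ⟨i, hi⟩ := hex
    refine ih _ (totalDegree_pderiv_lt i R hR) _ hi (μ := μ / a) hκ ha hG₀M hGM hG₀ hG htr
      ?_ rfl
    have h1 := pderiv_affineSubst S.σE (fun _ => a) b i R
    rw [hμ, pderiv_C_mul] at h1
    have hCa : (C a : MvPolynomial (Fin n) E) ≠ 0 := by simpa using ha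
    refine mul_left_cancel₀ hCa ?_
    rw [← h1, ← mul_assoc, ← C_mul, mul_div_cancel₀ _ ha]
  push Not at hex
  by_cases hzero : ∀ i, pderiv i R = 0
  -- R is a polynomial in the X_i^p; T has smaller degree and is an eigenvector for the data raised
  -- to the power p. The p-th roots of the constants found there give a combination whose p-th power
  -- is algebraic.
  · obtain ⟨T, rfl⟩ := exists_expand_eq_of_pderiv_eq_zero p R hzero
    have hTdeg : (expand p T).totalDegree = T.totalDegree * p := totalDegree_expand T
    have hT0 : T.totalDegree ≠ 0 := by
      intro h0
      simp [hTdeg, h0] at hR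
    rw [affineSubst_expand] at hμ
    obtain ⟨c₀, hc₀, c, hc, hcne, halg⟩ := ih T.totalDegree
      (by rw [hTdeg]; exact lt_mul_of_one_lt_right (Nat.pos_of_ne_zero hT0) hp.out.one_lt)
      T hT0 (κ := κ ^ p) (G₀ := G₀ ^ p) (a := a ^ p) (b := b ^ p) (G := G ^ p) (μ := μ)
      (pow_mem hκ p) (pow_ne_zero p ha) (pow_mem hG₀M p) (fun i => pow_mem (hGM i) p)
      (by rw [map_pow, hG₀]; simp [mul_pow])
      (fun i => by simp [hG, add_pow_expChar, mul_pow])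
      (htr.pow hp.out.pos)
      (expand_injective hp.out.pos (by rw [map_mul, expand_C]; exact hμ)) rfl
    obtain ⟨γ₀, hγ₀, rfl⟩ := S.perfect c₀ hc₀
    choose γ hγ hγc using fun i => S.perfect (c i) (hc i)
    refine ⟨γ₀, hγ₀, γ, hγ, ?_, ?_⟩
    · rintro rfl
      refine hcne (funext fun i => ?_)
      rw [← hγc i]
      simp [hp.out.ne_zero]
    · refine IsAlgebraic.of_pow hp.out.pos ?_
      convert halg using 1
      rw [add_pow_expChar, sum_pow_char]
      simp [mul_pow, ← hγc]
  push Not at hzero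
  obtain ⟨i, hi⟩ := hzero
  have hR0 : R ≠ 0 := by
    rintro rfl
    simp at hR
  obtain ⟨α, hα, hαdeg⟩ := exists_degree_eq_totalDegree hR0
  have hr : coeff α R ≠ 0 := mem_support_iff.1 hα
  set r := coeff α R with hrdef
  -- In top degree the shifts b play no role, so every top coefficient satisfies the same equation
  -- σ(x) a^deg = μ x.
  have htop : ∀ γ : Fin n →₀ ℕ, γ.degree = R.totalDegree →
      S.σE (coeff γ R) * a ^ R.totalDegree = μ * coeff γ R := by
    intro γ hγ
    have h1 := coeff_affineSubst S.σE (fun _ => a) b R γ hγ.ge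
    rw [hμ, coeff_C_mul] at h1
    rw [h1, ← hγ, Finsupp.prod, Finset.prod_pow_eq_pow_sum]
    rfl
  have hμr := htop α hαdeg
  rw [← hrdef] at hμr
  have hσr : S.σE r ≠ 0 := by simpa using hr
  have hμ' : μ = S.σE r * a ^ R.totalDegree / r := by
    rw [hμr, mul_div_cancel_right₀ _ hr]
  -- With deg R = m + 1 and a partial derivative c ≠ 0 in E, the equations for c and r give σ(c/r) =
  -- a^m (c/r). Hence G₀^m is c/r times a constant, which makes G₀ algebraic unless m = 0.
  have hdeg1 : R.totalDegree = 1 := by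
    obtain ⟨c, hc⟩ : ∃ c, pderiv i R = C c := ⟨_, totalDegree_eq_zero_iff_eq_C.1 (hex i)⟩
    have hc0 : c ≠ 0 := by
      rintro rfl
      exact hi (by simpa using hc)
    obtain ⟨m, hm⟩ := Nat.exists_eq_succ_of_ne_zero hR
    have h1 := pderiv_affineSubst S.σE (fun _ => a) b i R
    rw [hμ, pderiv_C_mul, hc, affineSubst_C, ← C_mul, ← C_mul] at h1
    have h2 : μ * c = a * S.σE c := C_injective _ _ h1
    have h3 : S.σE (c / r) = a ^ m * (c / r) := by
      rw [map_div₀, div_eq_iff hσr]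
      refine mul_left_cancel₀ ha ?_
      rw [← h2, hμ', hm, pow_succ]
      field_simp
    have h4 := S.div_pow_mem_const (y := algebraMap E Λ (c / r)) (m := m) hκ ha hG₀M hG₀
      (S.algebraMap_mem _) (by rw [S.map_algebraMap, h3]; simp)
    by_contra hne
    have hm0 : m ≠ 0 := by lia
    refine htr (IsAlgebraic.of_pow (Nat.pos_of_ne_zero hm0) ?_)
    have hcr : algebraMap E Λ (c / r) ≠ 0 := by
      simpa using ⟨hc0, hr⟩
    have h5 : G₀ ^ m = algebraMap E Λ (c / r) * (algebraMap E Λ (c / r) / G₀ ^ m)⁻¹ := by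
      rw [inv_div, mul_div_cancel₀ _ hcr]
    rw [h5]
    exact (isAlgebraic_algebraMap _).mul (S.isAlgebraic _ h4).inv
  have hlin := aeval_of_totalDegree_le_one (Λ := Λ) R hdeg1.le G
  -- The ratio of two top coefficients is fixed by σ, by `htop`.
  have hconst : ∀ j, algebraMap E Λ (coeff (Finsupp.single j 1) R / r) ∈ S.const := by
    intro j
    refine S.const_of_eigenvector 1 (one_mem _) _ (S.algebraMap_mem _) ?_
    rw [S.map_algebraMap, one_mul, map_div₀ S.σE]
    have h1 := htop (Finsupp.single j 1) (by rw [hdeg1]; simp)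
    congr 1
    rw [div_eq_div_iff hσr hr]
    refine mul_left_cancel₀ (pow_ne_zero R.totalDegree ha) ?_
    linear_combination r * h1 - coeff (Finsupp.single j 1) R * hμr
  have hr' : algebraMap E Λ r ≠ 0 := by simpa using hr
  set y := aeval G R / algebraMap E Λ r with hy
  have hyM : y ∈ S.M := by
    refine div_mem ?_ (S.algebraMap_mem _)
    rw [hlin]
    exact add_mem (S.algebraMap_mem _)
      (sum_mem fun j _ => mul_mem (S.algebraMap_mem _) (hGM j))
  have hσy : S.σ y = algebraMap E Λ a ^ 1 * y := by
    have h1 := aeval_affineSubst S.σE S.σ (fun x => (S.map_algebraMap x).symm) _ b G hG R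
    rw [hμ, map_mul, aeval_C] at h1
    have hσr' : algebraMap E Λ (S.σE r) ≠ 0 := by simpa using hσr
    rw [hy, map_div₀, ← h1, S.map_algebraMap, hμ', hdeg1]
    simp only [map_div₀, map_mul, map_pow]
    field_simp
  -- y and G₀ satisfy the same equation up to the constant κ, so their quotient is a constant; it
  -- supplies the coefficient of G₀.
  have hx := S.div_pow_mem_const hκ ha hG₀M hG₀ hyM hσy
  rw [pow_one] at hx
  have hG₀0 : G₀ ≠ 0 := by
    rintro rfl
    exact htr isAlgebraic_zero
  refine ⟨-(y / G₀), neg_mem hx, fun j => algebraMap E Λ (coeff (Finsupp.single j 1) R / r),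
    hconst, ?_, ?_⟩
  · intro h0
    obtain ⟨j, rfl⟩ := exists_eq_single_of_degree_eq_one (hαdeg.trans hdeg1)
    have := congrFun h0 j
    rw [← hrdef, div_self hr] at this
    simp at this
  · have : -(y / G₀) * G₀ + ∑ j, algebraMap E Λ (coeff (Finsupp.single j 1) R / r) * G j =
        algebraMap E Λ (-(coeff 0 R / r)) := by
      rw [neg_mul, div_mul_cancel₀ _ hG₀0, hy, hlin]
      simp only [map_neg, map_div₀, add_div, Finset.sum_div, div_mul_eq_mul_div]
      ring
    rw [this]
    exact isAlgebraic_algebraMap _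

theorem exists_linear_relation [hp : Fact p.Prime] [CharP E p] {n : ℕ}
    {κ : E} {G₀ : Λ} {a : E} {b : Fin n → E} {G : Fin n → Λ}
    (hκ : algebraMap E Λ κ ∈ S.const) (ha : a ≠ 0) (hG₀M : G₀ ∈ S.M) (hGM : ∀ i, G i ∈ S.M)
    (hG₀ : S.σ G₀ = algebraMap E Λ κ * algebraMap E Λ a * G₀)
    (hG : ∀ i, S.σ (G i) = algebraMap E Λ a * G i + algebraMap E Λ (b i))
    (hdep : ¬ AlgebraicIndependent E (Fin.cons G₀ G : Fin (n + 1) → Λ)) :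
    ∃ c : Fin (n + 1) → Λ, (∀ i, c i ∈ S.const) ∧ c ≠ 0 ∧
      IsAlgebraic E (∑ i, c i * (Fin.cons G₀ G : Fin (n + 1) → Λ) i) := by
  by_cases htr : Transcendental E G₀
  swap
  · refine ⟨Fin.cons 1 0, Fin.cases (one_mem _) fun i => zero_mem _, ?_, ?_⟩
    · intro h
      simpa using congrFun h 0
    · have := not_not.1 htr
      simpa [Fin.sum_univ_succ] using this
  set x : Fin (n + 1) → Λ := Fin.cons G₀ G with hx
  have hxσ : ∀ i, S.σ (x i) = algebraMap E Λ ((Fin.cons (κ * a) fun _ => a : Fin (n + 1) → E) i) *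
      x i + algebraMap E Λ ((Fin.cons 0 b : Fin (n + 1) → E) i) :=
    Fin.cases (by simp [hx, hG₀]) fun i => by simp [hx, hG]
  obtain ⟨P, hPI, hP0, μ, hμ⟩ := exists_relation_eigenvector S.σE
    (Fin.cons (κ * a) fun _ => a : Fin (n + 1) → E) (Fin.cons 0 b)
    (RingHom.ker (aeval x : MvPolynomial (Fin (n + 1)) E →ₐ[E] Λ))
    (fun P hP => by
      rw [RingHom.mem_ker] at hP ⊢
      rw [aeval_affineSubst S.σE S.σ (fun x => (S.map_algebraMap x).symm) _ _ x hxσ, hP, map_zero])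
    (by
      intro h
      exact hdep ((RingHom.injective_iff_ker_eq_bot _).2 h))
  rw [RingHom.mem_ker] at hPI
  have hcoeff : ∀ j, ((finSuccEquiv E n P).coeff j).totalDegree ≠ 0 →
      ∃ c : Fin (n + 1) → Λ, (∀ i, c i ∈ S.const) ∧ c ≠ 0 ∧ IsAlgebraic E (∑ i, c i * x i) := by
    intro j hj
    have h1 := coeff_finSuccEquiv_affineSubst S.σE (κ * a) (fun _ => a) b P j
    have h2 : (finSuccEquiv E n (C μ * P)).coeff j = C μ * (finSuccEquiv E n P).coeff j := by
      rw [map_mul, finSuccEquiv_apply (p := C μ)]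
      simp
    have hκa : κ * a ≠ 0 := by
      refine mul_ne_zero ?_ ha
      rintro rfl
      rw [map_zero, zero_mul, zero_mul, map_eq_zero] at hG₀
      exact htr (hG₀ ▸ isAlgebraic_zero)
    obtain ⟨c₀, hc₀, c, hc, hcne, halg⟩ := S.exists_linear_relation_of_eigenvector
      _ hj (μ := μ / (κ * a) ^ j) hκ ha hG₀M hGM hG₀ hG htr (by
        have hC : (C (κ * a) : MvPolynomial (Fin n) E) ^ j ≠ 0 := pow_ne_zero _ (by simpa using hκa)
        refine mul_right_cancel₀ hC ?_
        rw [← h1, hμ, h2, mul_right_comm, ← C_pow, ← C_mul,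
          div_mul_cancel₀ _ (pow_ne_zero j hκa)])
    refine ⟨Fin.cons c₀ c, Fin.cases hc₀ hc, ?_, ?_⟩
    · intro h
      exact hcne (funext fun i => by simpa using congrFun h i.succ)
    · simpa [Fin.sum_univ_succ, hx] using halg
  -- Otherwise every coefficient with respect to X₀ is constant, P involves X₀ alone, and G₀ is
  -- algebraic over E.
  by_contra hcon
  have hdeg : ∀ j, ∃ c, (finSuccEquiv E n P).coeff j = C c := fun j =>
    ⟨_, totalDegree_eq_zero_iff_eq_C.1 (not_not.1 fun h => hcon (hcoeff j h))⟩
  obtain ⟨f, hf⟩ : ∃ f : Polynomial E, f.map C = finSuccEquiv E n P := by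
    have : finSuccEquiv E n P ∈ Polynomial.lifts C :=
      (Polynomial.lifts_iff_coeff_lifts _).2 fun j => by
        obtain ⟨c, hc⟩ := hdeg j
        exact ⟨c, hc.symm⟩
    exact (Polynomial.mem_lifts _).1 this
  refine htr ⟨f, ?_, ?_⟩
  · rintro rfl
    rw [Polynomial.map_zero, eq_comm, EmbeddingLike.map_eq_zero_iff] at hf
    exact hP0 hf
  · have h1 : P = Polynomial.aeval (X 0) f := by
      apply (finSuccEquiv E n).injective
      rw [← hf, ← Polynomial.aeval_algHom_apply, finSuccEquiv_X_zero, Polynomial.aeval_def,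
        Polynomial.map, Polynomial.eval₂_eq_eval_map, Polynomial.eval₂_eq_eval_map]
      rfl
    rw [h1, ← Polynomial.aeval_algHom_apply] at hPI
    simpa [hx] using hPI

end DifferenceExtension

end DifferenceFields

end CarlitzMahler

namespace CarlitzMahler

/-! ### The absolute value of `ℂ_∞` -/

section Norm

variable (Fq : Type*) [Field Fq] [Finite Fq]

theorem isUltrametricDist_cInf : IsUltrametricDist (CInf Fq) := by
  refine IsUltrametricDist.isUltrametricDist_of_forall_norm_add_le_max_norm fun x y => ?_
  refine UniformSpace.Completion.induction_on₂ x y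
    (isClosed_le (by fun_prop) (by fun_prop)) fun a b => ?_
  rw [← UniformSpace.Completion.coe_add, UniformSpace.Completion.norm_coe,
    UniformSpace.Completion.norm_coe, UniformSpace.Completion.norm_coe]
  exact isNonarchimedean_spectralNorm (K := KInf Fq) (L := AlgebraicClosure (KInf Fq)) a b

theorem norm_invThetaInf : ‖invThetaInf Fq‖ = (q Fq : ℝ)⁻¹ := by
  have h : ‖invThetaInf Fq‖ = ((WithZeroMulInt.toNNReal (one_pos.trans (one_lt_q Fq)).ne')
      ((Valued.v : Valuation (KInf Fq) ℤᵐ⁰) (invThetaInf Fq)) : ℝ≥0) := by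
    rw [← Valuation.embedding_restrict]
    rfl
  rw [h, valued_invThetaInf, WithZeroMulInt.toNNReal_neg_apply _ (by simp)]
  have hexp : (WithZero.unzero (WithZero.exp_ne_zero (a := (-1 : ℤ)))).toAdd = -1 := rfl
  rw [hexp]
  simp

theorem norm_theta : ‖theta Fq‖ = q Fq := by
  rw [theta, UniformSpace.Completion.norm_coe]
  have : ‖algebraMap (KInf Fq) (AlgebraicClosure (KInf Fq)) (invThetaInf Fq)⁻¹‖ =
      ‖(invThetaInf Fq)⁻¹‖ := spectralNorm_extends _
  rw [this, norm_inv, norm_invThetaInf, inv_inv]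

theorem exists_q_eq_prime_pow :
    ∃ p r : ℕ, p.Prime ∧ CharP Fq p ∧ q Fq = p ^ r := by
  have := Fintype.ofFinite Fq
  obtain ⟨p, hp⟩ := CharP.exists Fq
  obtain ⟨r, hpp, hr⟩ := FiniteField.card Fq p
  exact ⟨p, r, hpp, hp, by rw [← hr, q, Nat.card_eq_fintype_card]⟩

/-- The `q^d`-power Frobenius endomorphism of `ℂ_∞`. -/
noncomputable def frob (d : ℕ) : CInf Fq →+* CInf Fq where
  toFun x := x ^ (q Fq ^ d)
  map_one' := one_pow _
  map_mul' x y := mul_pow x y _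
  map_zero' := zero_pow (pow_ne_zero _ Nat.card_pos.ne')
  map_add' x y := by
    obtain ⟨p, r, hp, hchar, hq⟩ := exists_q_eq_prime_pow Fq
    have := Fact.mk hp
    have : CharP (CInf Fq) p := charP_of_injective_algebraMap (algebraMap Fq (CInf Fq)).injective p
    rw [hq, ← pow_mul, add_pow_char_pow]

@[simp]
theorem frob_apply (d : ℕ) (x : CInf Fq) : frob Fq d x = x ^ (q Fq ^ d) := rfl

variable {Fq}

/-- A nonzero c is a root of unity of order dividing q^d - 1, the exponent written `1 + m` below. -/
theorem norm_eq_one_of_frob_fixed {d : ℕ} (hd : 1 ≤ d) {c : CInf Fq} (hc : c ^ (q Fq ^ d) = c)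
    (h0 : c ≠ 0) : ‖c‖ = 1 := by
  have h2 : 1 < q Fq ^ d := Nat.one_lt_pow (by lia) (Finite.one_lt_card (α := Fq))
  obtain ⟨m, hm⟩ := Nat.exists_eq_add_of_lt h2
  have h1 : c ^ (1 + m) = 1 := by
    refine mul_right_cancel₀ h0 ?_
    rw [← pow_succ, one_mul, ← hm, hc]
  have h3 : ‖c‖ ^ (1 + m) = 1 := by rw [← norm_pow, h1, norm_one]
  exact (pow_eq_one_iff_of_nonneg (norm_nonneg c) (by lia)).1 h3

theorem norm_le_one_of_frob_fixed {d : ℕ} (hd : 1 ≤ d) {c : CInf Fq}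
    (hc : c ^ (q Fq ^ d) = c) : ‖c‖ ≤ 1 := by
  by_cases h0 : c = 0
  · simp [h0]
  · exact (norm_eq_one_of_frob_fixed hd hc h0).le

end Norm

/-! ### Expansions in powers of `u` -/

section Expansion

open PowerSeries

variable {Fq : Type*} [Field Fq] [Finite Fq] {d : ℕ} {u : CInf Fq}

theorem map_frob_eq_self_iff {f : (CInf Fq)⟦X⟧} :
    PowerSeries.map (frob Fq d) f = f ↔ ∀ j, coeff j f ^ (q Fq ^ d) = coeff j f := by
  simp [PowerSeries.ext_iff]

theorem IsExpansion.map_frob {f : (CInf Fq)⟦X⟧} {x : CInf Fq} (h : IsExpansion d u f x) :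
    PowerSeries.map (frob Fq d) f = f :=
  map_frob_eq_self_iff.2 h.1

theorem IsExpansion.add {f g : (CInf Fq)⟦X⟧} {x y : CInf Fq} (hf : IsExpansion d u f x)
    (hg : IsExpansion d u g y) : IsExpansion d u (f + g) (x + y) := by
  refine ⟨map_frob_eq_self_iff.1 ?_, ?_⟩
  · rw [map_add, hf.map_frob, hg.map_frob]
  · simpa [add_mul] using hf.2.add hg.2

theorem IsExpansion.summable_norm (hd : 1 ≤ d) (hu : ‖u‖ < 1) {f : (CInf Fq)⟦X⟧} {x : CInf Fq}
    (hf : IsExpansion d u f x) : Summable fun j => ‖coeff j f * u ^ j‖ := by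
  refine Summable.of_nonneg_of_le (fun _ => norm_nonneg _) (fun j => ?_)
    (summable_geometric_of_lt_one (norm_nonneg u) hu)
  rw [norm_mul, norm_pow]
  exact mul_le_of_le_one_left (by positivity) (norm_le_one_of_frob_fixed hd (hf.1 j))

theorem IsExpansion.mul (hd : 1 ≤ d) (hu : ‖u‖ < 1) {f g : (CInf Fq)⟦X⟧} {x y : CInf Fq}
    (hf : IsExpansion d u f x) (hg : IsExpansion d u g y) :
    IsExpansion d u (f * g) (x * y) := by
  refine ⟨map_frob_eq_self_iff.1 ?_, ?_⟩
  · rw [map_mul, hf.map_frob, hg.map_frob]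
  · have h1 := summable_norm_sum_mul_antidiagonal_of_summable_norm (hf.summable_norm hd hu)
      (hg.summable_norm hd hu)
    have h2 := tsum_mul_tsum_eq_tsum_sum_antidiagonal_of_summable_norm (hf.summable_norm hd hu)
      (hg.summable_norm hd hu)
    rw [hf.2.tsum_eq, hg.2.tsum_eq] at h2
    rw [h2]
    refine h1.of_norm.hasSum.congr_fun fun j => ?_
    rw [PowerSeries.coeff_mul, Finset.sum_mul]
    refine Finset.sum_congr rfl fun ij hij => ?_
    rw [← Finset.HasAntidiagonal.mem_antidiagonal.1 hij, pow_add]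
    ring

theorem isExpansion_C (c : CInf Fq) (hc : c ^ (q Fq ^ d) = c) :
    IsExpansion d u (PowerSeries.C c) c := by
  refine ⟨map_frob_eq_self_iff.1 (by rw [PowerSeries.map_C, frob_apply, hc]), ?_⟩
  convert hasSum_single 0 fun j hj => ?_ using 1
  · simp
  · simp [PowerSeries.coeff_C, hj]

theorem isExpansion_X : IsExpansion d u (PowerSeries.X) u := by
  refine ⟨map_frob_eq_self_iff.1 (by rw [PowerSeries.map_X]), ?_⟩
  convert hasSum_single 1 fun j hj => ?_ using 1
  · simp
  · simp [PowerSeries.coeff_X, hj]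

theorem IsExpansion.norm_le_one (hd : 1 ≤ d) (hu : ‖u‖ < 1) {f : (CInf Fq)⟦X⟧} {x : CInf Fq}
    (hf : IsExpansion d u f x) : ‖x‖ ≤ 1 := by
  have := isUltrametricDist_cInf Fq
  have hcl : IsClosed {y : CInf Fq | ‖y‖ ≤ 1} := isClosed_le continuous_norm continuous_const
  refine hcl.mem_of_tendsto hf.2 (Filter.Eventually.of_forall fun s => ?_)
  refine IsUltrametricDist.norm_sum_le_of_forall_le_of_nonneg zero_le_one fun j _ => ?_
  rw [norm_mul, norm_pow]
  exact mul_le_one₀ (norm_le_one_of_frob_fixed hd (hf.1 j)) (by positivity)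
    (pow_le_one₀ (norm_nonneg u) hu.le)

theorem IsExpansion.exists_shift (hd : 1 ≤ d) (hu : ‖u‖ < 1) {f : (CInf Fq)⟦X⟧} {x : CInf Fq}
    (hf : IsExpansion d u f x) :
    ∃ y, IsExpansion d u (PowerSeries.mk fun j => coeff (j + 1) f) y ∧
      x = coeff 0 f + u * y := by
  have hfix : ∀ j, coeff j (PowerSeries.mk fun j => coeff (j + 1) f) ^ (q Fq ^ d) =
      coeff j (PowerSeries.mk fun j => coeff (j + 1) f) := fun j => by
    simpa using hf.1 (j + 1)
  have hsum : Summable fun j => ‖coeff j (PowerSeries.mk fun j => coeff (j + 1) f) * u ^ j‖ := by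
    refine Summable.of_nonneg_of_le (fun _ => norm_nonneg _) (fun j => ?_)
      (summable_geometric_of_lt_one (norm_nonneg u) hu)
    rw [norm_mul, norm_pow]
    exact mul_le_of_le_one_left (by positivity) (norm_le_one_of_frob_fixed hd (hfix j))
  refine ⟨_, ⟨hfix, hsum.of_norm.hasSum⟩, ?_⟩
  have h1 := hf.2.summable.tsum_eq_zero_add
  rw [hf.2.tsum_eq, pow_zero, mul_one] at h1
  rw [h1, ← tsum_mul_left]
  congr 1
  refine tsum_congr fun j => ?_
  rw [PowerSeries.coeff_mk, pow_succ]
  ring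

/-- The difference f(u) - f(0) is u times an element of norm at most 1, so |f(0)| < 1; but elements
of 𝔽_{q^d} have norm 0 or 1. -/
theorem IsExpansion.coeff_zero_eq_zero (hd : 1 ≤ d) (hu : ‖u‖ < 1) {f : (CInf Fq)⟦X⟧}
    {x : CInf Fq} (hf : IsExpansion d u f x) (hx : ‖x‖ < 1) : coeff 0 f = 0 := by
  by_contra h0
  have := isUltrametricDist_cInf Fq
  obtain ⟨y, hy, hxy⟩ := hf.exists_shift hd hu
  have h1 : ‖coeff 0 f‖ < 1 := by
    have : coeff 0 f = x + -(u * y) := by rw [hxy]; ring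
    rw [this]
    refine (IsUltrametricDist.norm_add_le_max x (-(u * y))).trans_lt (max_lt hx ?_)
    rw [norm_neg, norm_mul]
    exact (mul_le_of_le_one_right (norm_nonneg u) (hy.norm_le_one hd hu)).trans_lt hu
  exact h1.ne (norm_eq_one_of_frob_fixed hd (hf.1 0) h0)

/-- The constant term vanishes, and after division by u the same holds for the shifted series. Thus
evaluation at u is injective on 𝔽_{q^d}[[Z]], and relations between values lift to the series. -/
theorem IsExpansion.eq_zero (hd : 1 ≤ d) (hu0 : u ≠ 0) (hu : ‖u‖ < 1) {f : (CInf Fq)⟦X⟧}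
    (hf : IsExpansion d u f 0) : f = 0 := by
  have key : ∀ j (f : (CInf Fq)⟦X⟧), IsExpansion d u f 0 → coeff j f = 0 := by
    intro j
    induction j with
    | zero => exact fun f hf => hf.coeff_zero_eq_zero hd hu (by simp)
    | succ j ih =>
      intro f hf
      obtain ⟨y, hy, hxy⟩ := hf.exists_shift hd hu
      rw [hf.coeff_zero_eq_zero hd hu (by simp), zero_add, eq_comm, mul_eq_zero] at hxy
      obtain rfl := hxy.resolve_left hu0
      simpa using ih _ hy
  ext j
  simpa using key j f hf

theorem algebraMap_pow_q_pow (c : Fq) :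
    algebraMap Fq (CInf Fq) c ^ (q Fq ^ d) = algebraMap Fq (CInf Fq) c := by
  have := Fintype.ofFinite Fq
  rw [← map_pow, q, Nat.card_eq_fintype_card, FiniteField.pow_card_pow]

theorem IsExpansion.aeval (hd : 1 ≤ d) (hu : ‖u‖ < 1) {ι : Type*} {f : ι → (CInf Fq)⟦X⟧}
    {x : ι → CInf Fq} (hf : ∀ i, IsExpansion d u (f i) (x i)) (P : MvPolynomial ι Fq) :
    IsExpansion d u (MvPolynomial.aeval f P) (MvPolynomial.aeval x P) := by
  induction P using MvPolynomial.induction_on with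
  | C c =>
    rw [MvPolynomial.aeval_C, MvPolynomial.aeval_C, PowerSeries.algebraMap_apply]
    exact isExpansion_C _ (algebraMap_pow_q_pow c)
  | add P Q hP hQ =>
    rw [map_add, map_add]
    exact hP.add hQ
  | mul_X P i hP =>
    rw [map_mul, map_mul, MvPolynomial.aeval_X, MvPolynomial.aeval_X]
    exact hP.mul hd hu (hf i)

end Expansion

/-! ### Algebraicity of expansions -/

section Algebraicity

variable {Fq : Type*} [Field Fq] [Finite Fq]

/-- k̄ is algebraic over 𝔽_q(θ), so its transcendence degree over 𝔽_q is at most 1. -/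
theorem not_algebraicIndependent_pair {u x : CInf Fq} (hu : u ∈ kBar Fq) (hx : x ∈ kBar Fq) :
    ¬ AlgebraicIndependent Fq (fun o : Option Unit => o.elim x fun _ => u) := by
  intro hind
  let A : IntermediateField Fq (CInf Fq) := (kBar Fq).restrictScalars Fq
  have hθA : theta Fq ∈ A := by
    have : theta Fq ∈ k Fq := IntermediateField.mem_adjoin_simple_self Fq _
    exact (kBar Fq).algebraMap_mem ⟨theta Fq, this⟩
  let y : Option Unit → A := fun o => o.elim ⟨x, hx⟩ fun _ => ⟨u, hu⟩
  have hy : AlgebraicIndependent Fq y := by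
    refine AlgebraicIndependent.of_comp A.val ?_
    convert hind using 1
    ext (_ | _) <;> rfl
  have halg : Algebra.IsAlgebraic (IntermediateField.adjoin Fq {(⟨theta Fq, hθA⟩ : A)}) A := by
    set F := IntermediateField.adjoin Fq {(⟨theta Fq, hθA⟩ : A)} with hF
    have hkF : k Fq ≤ F.map A.val := by
      rw [IntermediateField.adjoin_simple_le_iff]
      exact ⟨_, IntermediateField.mem_adjoin_simple_self Fq _, rfl⟩
    have hkA : k Fq ≤ A := fun c hc => (kBar Fq).algebraMap_mem ⟨c, hc⟩
    let f : k Fq →+* F := (IntermediateField.inclusion hkA).toRingHom.codRestrict F fun c => by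
      obtain ⟨y, hy, hyc⟩ := hkF c.2
      have : IntermediateField.inclusion hkA c = y := Subtype.ext hyc.symm
      exact this ▸ hy
    refine ⟨fun a => ?_⟩
    have ha : IsAlgebraic (k Fq) (⟨a.1, a.2⟩ : kBar Fq) := Algebra.IsAlgebraic.isAlgebraic _
    exact ha.ringHom_of_comp_eq f (RingHom.id A) f.injective rfl
  have := IntermediateField.isAlgebraic_adjoin_iff_top.1 halg
  have h1 := hy.lift_cardinalMk_le_trdeg
  have h2 := Algebra.IsAlgebraic.trdeg_le_cardinalMk Fq {(⟨theta Fq, hθA⟩ : A)}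
  have h3 := h1.trans (Cardinal.lift_le.2 h2)
  simp [Cardinal.mk_fintype] at h3

theorem algebraMap_laurentSeries (c : Fq) :
    algebraMap Fq (CInf Fq)⸨X⸩ c = HahnSeries.C (algebraMap Fq (CInf Fq) c) := by
  rw [HahnSeries.algebraMap_apply', PowerSeries.algebraMap_apply, HahnSeries.ofPowerSeries_C]

theorem algebraMap_k_laurentSeries (c : k Fq) :
    algebraMap (k Fq) (CInf Fq)⸨X⸩ c = HahnSeries.C (c : CInf Fq) := by
  have h : algebraMap (CInf Fq) (CInf Fq)⸨X⸩ c = HahnSeries.C (c : CInf Fq) := by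
    rw [HahnSeries.algebraMap_apply', PowerSeries.algebraMap_apply, HahnSeries.ofPowerSeries_C]
    rfl
  exact h

theorem transcendental_single_one :
    Transcendental Fq (HahnSeries.single (1 : ℤ) (1 : CInf Fq)) := by
  rw [transcendental_iff]
  intro P hP
  have h1 : (HahnSeries.ofPowerSeries ℤ (CInf Fq))
      ((P.map (algebraMap Fq (CInf Fq)) : Polynomial (CInf Fq)) : (CInf Fq)⟦X⟧) =
      Polynomial.aeval (HahnSeries.single (1 : ℤ) (1 : CInf Fq)) P := by
    have h2 : ((HahnSeries.ofPowerSeries ℤ (CInf Fq)).comp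
        Polynomial.coeToPowerSeries.ringHom).comp (Polynomial.mapRingHom (algebraMap Fq (CInf Fq)))
        = (Polynomial.aeval (HahnSeries.single (1 : ℤ) (1 : CInf Fq)) :
          Polynomial Fq →ₐ[Fq] HahnSeries ℤ (CInf Fq)).toRingHom := by
      refine Polynomial.ringHom_ext (fun c => ?_) ?_
      · have := algebraMap_laurentSeries c
        simp_all
      · simp
    exact congrArg (fun g : Polynomial Fq →+* HahnSeries ℤ (CInf Fq) => g P) h2
  rw [hP, map_eq_zero_iff _ HahnSeries.ofPowerSeries_injective, Polynomial.coe_eq_zero_iff,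
    Polynomial.map_eq_zero] at h1
  exact h1

/-- A nonzero P over 𝔽_q with P(x, u) = 0 exists. The series P(f, Z) has coefficients in 𝔽_{q^d} and
vanishes at u, so it is zero; as Z is transcendental over 𝔽_q, f is algebraic over 𝔽_q[Z]. -/
theorem IsExpansion.isAlgebraic {d : ℕ} {u x : CInf Fq} {f : (CInf Fq)⟦X⟧} (hd : 1 ≤ d)
    (hu0 : u ≠ 0) (hu : ‖u‖ < 1) (huk : u ∈ kBar Fq) (hxk : x ∈ kBar Fq)
    (hf : IsExpansion d u f x) :
    IsAlgebraic (kZ Fq) (HahnSeries.ofPowerSeries ℤ (CInf Fq) f) := by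
  have hnind : ¬ AlgebraicIndependent Fq (fun o : Option Unit =>
      o.elim (HahnSeries.ofPowerSeries ℤ (CInf Fq) f)
        fun _ => HahnSeries.single (1 : ℤ) (1 : CInf Fq)) := by
    intro hind
    refine not_algebraicIndependent_pair huk hxk
      (algebraicIndependent_iff.2 fun P hP => algebraicIndependent_iff.1 hind P ?_)
    have h1 := IsExpansion.aeval hd hu (d := d) (u := u)
      (f := fun o : Option Unit => o.elim f fun _ => PowerSeries.X)
      (x := fun o : Option Unit => o.elim x fun _ => u)
      (by rintro (_ | _); exacts [hf, isExpansion_X]) P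
    rw [hP] at h1
    let ψ : (CInf Fq)⟦X⟧ →ₐ[Fq] (CInf Fq)⸨X⸩ :=
      { HahnSeries.ofPowerSeries ℤ (CInf Fq) with commutes' := fun _ => rfl }
    have h2 := congrArg ψ (h1.eq_zero hd hu0 hu)
    rw [map_zero, ← AlgHom.comp_apply, MvPolynomial.comp_aeval] at h2
    have h3 : (fun o : Option Unit => ψ (o.elim f fun _ => PowerSeries.X)) = fun o : Option Unit =>
        o.elim (HahnSeries.ofPowerSeries ℤ (CInf Fq) f)
          fun _ => HahnSeries.single (1 : ℤ) (1 : CInf Fq) := by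
      funext o
      rcases o with _ | _
      · rfl
      · exact HahnSeries.ofPowerSeries_X
    rw [h3] at h2
    exact h2
  have hZ : AlgebraicIndependent Fq
      fun _ : Unit => HahnSeries.single (1 : ℤ) (1 : CInf Fq) :=
    algebraicIndependent_unique_type_iff.2 transcendental_single_one
  rw [hZ.option_iff_transcendental, Transcendental, not_not] at hnind
  have hle : ∀ y ∈ Algebra.adjoin Fq
      (Set.range fun _ : Unit => HahnSeries.single (1 : ℤ) (1 : CInf Fq)), y ∈ kZ Fq := by
    intro y hy
    induction hy using Algebra.adjoin_induction with
    | mem y hy =>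
      obtain ⟨-, rfl⟩ := hy
      exact IntermediateField.mem_adjoin_simple_self _ _
    | algebraMap c =>
      have : algebraMap Fq (HahnSeries ℤ (CInf Fq)) c =
          algebraMap (k Fq) (CInf Fq)⸨X⸩ (algebraMap Fq (k Fq) c) := by
        rw [algebraMap_k_laurentSeries]
        exact algebraMap_laurentSeries c
      rw [this]
      exact (kZ Fq).algebraMap_mem _
    | add y z _ _ hy hz => exact add_mem hy hz
    | mul y z _ _ hy hz => exact mul_mem hy hz
  let g : Algebra.adjoin Fq
      (Set.range fun _ : Unit => HahnSeries.single (1 : ℤ) (1 : CInf Fq)) →+* kZ Fq :=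
    (Subalgebra.val _).toRingHom.codRestrict (kZ Fq) fun y => hle y y.2
  exact hnind.ringHom_of_comp_eq g (RingHom.id _)
    (fun y z h => Subtype.ext (congrArg (fun t : kZ Fq => (t : (CInf Fq)⸨X⸩)) h)) rfl

end Algebraicity

end CarlitzMahler

namespace CarlitzMahler

/-! ### Functional equations of the interpolation series -/

/-! ### Inverses, subfields of coefficients and limits of power series. -/

section PowerSeriesField

open PowerSeries

variable {L : Type*} [Field L]

theorem map_powerSeries_inv {L' H : Type*} [Field L'] [FunLike H L⟦X⟧ L'⟦X⟧]
    [RingHomClass H L⟦X⟧ L'⟦X⟧] (φ : H) {f : L⟦X⟧}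
    (hf : constantCoeff f ≠ 0) (hφ : constantCoeff (φ f) ≠ 0) : φ f⁻¹ = (φ f)⁻¹ := by
  rw [PowerSeries.eq_inv_iff_mul_eq_one hφ, ← map_mul, PowerSeries.inv_mul_cancel f hf, map_one]

theorem ofPowerSeries_inv {f : L⟦X⟧} (hf : constantCoeff f ≠ 0) :
    HahnSeries.ofPowerSeries ℤ L f⁻¹ = (HahnSeries.ofPowerSeries ℤ L f)⁻¹ := by
  refine eq_inv_of_mul_eq_one_left ?_
  rw [← map_mul, PowerSeries.inv_mul_cancel f hf, map_one]

theorem coeff_eq_of_X_pow_dvd_sub {f g : L⟦X⟧} {N n : ℕ} (h : X ^ N ∣ f - g) (hn : n < N) :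
    coeff n f = coeff n g := by
  have := (X_pow_dvd_iff.1 h) n hn
  rwa [map_sub, sub_eq_zero] at this

theorem X_pow_dvd_pow_of_constantCoeff_eq_zero {f : L⟦X⟧} (hf : constantCoeff f = 0) (N : ℕ) :
    X ^ N ∣ f ^ N :=
  pow_dvd_pow_of_dvd (X_dvd_iff.2 hf) N

theorem tendsto_order_of_X_pow_dvd {f : ℕ → L⟦X⟧} (h : ∀ m, X ^ m ∣ f m) :
    Filter.Tendsto (fun m => (f m).order) Filter.atTop (nhds ⊤) := by
  rw [ENat.tendsto_nhds_top_iff_natCast_lt]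
  intro n
  filter_upwards [Filter.eventually_gt_atTop n] with m hm
  exact (Nat.cast_lt.2 hm).trans_le (le_order _ _ fun i hi =>
    X_pow_dvd_iff.1 (h m) i (by exact_mod_cast hi))

theorem mem_range_map_subtype_iff (F : Subfield L) {f : L⟦X⟧} :
    f ∈ (PowerSeries.map F.subtype).range ↔ ∀ j, coeff j f ∈ F := by
  constructor
  · rintro ⟨g, rfl⟩ j
    simp
  · intro h
    refine ⟨PowerSeries.mk fun j => ⟨coeff j f, h j⟩, ?_⟩
    ext j
    simp

theorem C_mem_range_map_subtype (F : Subfield L) {c : L} (hc : c ∈ F) :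
    PowerSeries.C c ∈ (PowerSeries.map F.subtype).range :=
  ⟨PowerSeries.C ⟨c, hc⟩, by simp⟩

theorem inv_mem_range_map_subtype (F : Subfield L) {f : L⟦X⟧}
    (hf : f ∈ (PowerSeries.map F.subtype).range) (h0 : constantCoeff f ≠ 0) :
    f⁻¹ ∈ (PowerSeries.map F.subtype).range := by
  obtain ⟨g, rfl⟩ := hf
  refine ⟨g⁻¹, map_powerSeries_inv _ ?_ h0⟩
  intro h
  refine h0 ?_
  rw [← coeff_zero_eq_constantCoeff_apply, coeff_map, coeff_zero_eq_constantCoeff_apply, h,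
    map_zero]

section Topology

open scoped PowerSeries.WithPiTopology

variable [TopologicalSpace L]

theorem continuous_expand {N : ℕ} (hN : N ≠ 0) : Continuous (PowerSeries.expand (R := L) N hN) := by
  rw [continuous_iff_continuousAt]
  intro f
  rw [ContinuousAt, PowerSeries.WithPiTopology.tendsto_iff_coeff_tendsto]
  intro n
  simp only [coeff_expand]
  split_ifs
  · exact (PowerSeries.WithPiTopology.continuous_coeff L _).tendsto f
  · exact tendsto_const_nhds

/-- Each coefficient of the sequence is eventually constant, so the limit has coefficients in F even
when F is not closed in L. -/
theorem mem_range_map_subtype_of_tendsto [T2Space L] (F : Subfield L) {f : ℕ → L⟦X⟧} {g : L⟦X⟧}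
    (hf : ∀ N, f N ∈ (PowerSeries.map F.subtype).range)
    (hstep : ∀ N, X ^ N ∣ f (N + 1) - f N)
    (hlim : Filter.Tendsto f Filter.atTop (nhds g)) :
    g ∈ (PowerSeries.map F.subtype).range := by
  rw [mem_range_map_subtype_iff]
  intro n
  have hconst : ∀ N, n + 1 ≤ N → coeff n (f N) = coeff n (f (n + 1)) := by
    intro N hN
    induction N, hN using Nat.le_induction with
    | base => rfl
    | succ N hN ih => rw [coeff_eq_of_X_pow_dvd_sub (hstep N) (by lia), ih]
  have h1 := (PowerSeries.WithPiTopology.tendsto_iff_coeff_tendsto L _ _ _).1 hlim n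
  have h2 : Filter.Tendsto (fun N => coeff n (f N)) Filter.atTop (nhds (coeff n (f (n + 1)))) :=
    tendsto_const_nhds.congr' (by
      filter_upwards [Filter.eventually_ge_atTop (n + 1)] with N hN
      exact (hconst N hN).symm)
  rw [tendsto_nhds_unique h1 h2]
  exact (mem_range_map_subtype_iff F).1 (hf _) n

end Topology

end PowerSeriesField

/-! ### The action of Z ↦ Z^(q^d) on π_m, G₀ and Gᵢ. -/

section FunctionalEquations

open PowerSeries

variable {Fq : Type*} [Field Fq] [Finite Fq]

theorem q_pow_ne_zero (d : ℕ) : q Fq ^ d ≠ 0 := pow_ne_zero _ Nat.card_pos.ne'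

theorem lt_q_pow (m : ℕ) : m < q Fq ^ m := Nat.lt_pow_self (Finite.one_lt_card (α := Fq))

theorem expand_eq_pow_of_map_frob {d : ℕ} {f : (CInf Fq)⟦X⟧}
    (hf : PowerSeries.map (frob Fq d) f = f) :
    PowerSeries.expand (q Fq ^ d) (q_pow_ne_zero d) f = f ^ (q Fq ^ d) := by
  obtain ⟨p, r, hp, hchar, hq⟩ := exists_q_eq_prime_pow Fq
  have := Fact.mk hp
  have : CharP (CInf Fq) p := charP_of_injective_algebraMap (algebraMap Fq (CInf Fq)).injective p
  have : ExpChar (CInf Fq) p := ExpChar.prime hp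
  have hqd : q Fq ^ d = p ^ (r * d) := by rw [hq, pow_mul]
  have hfrob : frob Fq d = iterateFrobenius (CInf Fq) p (r * d) := by
    ext x
    rw [frob_apply, iterateFrobenius_def, hqd]
  have h1 : PowerSeries.map (frob Fq d) (PowerSeries.expand (q Fq ^ d) (q_pow_ne_zero d) f) =
      f ^ (q Fq ^ d) := by
    rw [hfrob]
    simp only [hqd]
    exact MvPowerSeries.map_iterateFrobenius_expand p hp.ne_zero f (r * d)
  rw [← h1, PowerSeries.map_expand, hf]

variable {l : (CInf Fq)⟦X⟧}

/-- The factor `1 - θ 𝐥(Z)^(q^i)`. -/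
noncomputable def carlitzFactor (l : (CInf Fq)⟦X⟧) (i : ℕ) : (CInf Fq)⟦X⟧ :=
  1 - PowerSeries.C (theta Fq) * l ^ (q Fq ^ i)

theorem constantCoeff_carlitzFactor (hl0 : constantCoeff l = 0) (i : ℕ) : constantCoeff (carlitzFactor l i) = 1 := by
  rw [carlitzFactor, map_sub, map_mul, map_pow, hl0, zero_pow (q_pow_ne_zero i)]
  simp

theorem constantCoeff_piSeries_ne_zero (hl0 : constantCoeff l = 0) {β : CInf Fq} (hβ : β ≠ 0) (s m : ℕ) :
    constantCoeff (piSeries l β s m) ≠ 0 := by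
  have h : ∀ i, constantCoeff (1 - PowerSeries.C (theta Fq) * l ^ (q Fq ^ i)) = 1 :=
    constantCoeff_carlitzFactor hl0
  simp [piSeries, map_prod, h, hβ]

theorem expand_carlitzFactor {d : ℕ} (hl : PowerSeries.map (frob Fq d) l = l) (i : ℕ) :
    PowerSeries.expand (q Fq ^ d) (q_pow_ne_zero d) (carlitzFactor l i) =
      carlitzFactor l (i + d) := by
  rw [carlitzFactor, map_sub, map_one, map_mul, map_pow, PowerSeries.expand_C,
    expand_eq_pow_of_map_frob hl, ← pow_mul, ← pow_add, add_comm d i, carlitzFactor]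

theorem piSeries_eq (l : (CInf Fq)⟦X⟧) (β : CInf Fq) (s m : ℕ) :
    piSeries l β s m =
      PowerSeries.C (β⁻¹ ^ m) * ∏ i ∈ Finset.range m, carlitzFactor l (i + 1) ^ s := by
  rw [piSeries, Finset.range_eq_Ico, Finset.prod_Ico_add' (fun i => carlitzFactor l i ^ s) 0 m 1]
  rfl

/-- The substitution shifts the index of each factor by d, and π_d supplies the first d factors
together with the missing β^(-d). -/
theorem expand_piSeries_mul {d : ℕ} (hl : PowerSeries.map (frob Fq d) l = l) (β : CInf Fq)
    (s m : ℕ) :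
    PowerSeries.expand (q Fq ^ d) (q_pow_ne_zero d) (piSeries l β s m) * piSeries l β s d =
      piSeries l β s (m + d) := by
  rw [piSeries_eq, piSeries_eq, piSeries_eq, map_mul, PowerSeries.expand_C, map_prod,
    add_comm m d, Finset.prod_range_add, pow_add, map_mul]
  simp only [map_pow, expand_carlitzFactor hl]
  have : ∀ i, i + 1 + d = d + i + 1 := fun i => by lia
  simp only [this]
  ring

theorem X_pow_dvd_carlitzFactor_inv_pow_sub_one (hl0 : constantCoeff l = 0) (s m : ℕ) :
    X ^ m ∣ (carlitzFactor l (m + 1))⁻¹ ^ s - 1 := by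
  have h0 : constantCoeff (carlitzFactor l (m + 1)) ≠ 0 := by
    rw [constantCoeff_carlitzFactor hl0]
    exact one_ne_zero
  have h1 : X ^ m ∣ (carlitzFactor l (m + 1))⁻¹ - 1 := by
    have h2 : (carlitzFactor l (m + 1))⁻¹ - 1 =
        (carlitzFactor l (m + 1))⁻¹ * (PowerSeries.C (theta Fq)) * l ^ (q Fq ^ (m + 1)) := by
      have h3 := PowerSeries.inv_mul_cancel _ h0
      have h4 : (PowerSeries.C (theta Fq)) * l ^ (q Fq ^ (m + 1)) =
        1 - carlitzFactor l (m + 1) := by rw [carlitzFactor]; ring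
      rw [mul_assoc, h4, mul_sub, h3, mul_one]
    rw [h2]
    refine Dvd.dvd.mul_left ?_ _
    refine (pow_dvd_pow X ?_).trans (X_pow_dvd_pow_of_constantCoeff_eq_zero hl0 _)
    exact (Nat.le_succ m).trans (lt_q_pow (Fq := Fq) (m + 1)).le
  have h5 := sub_dvd_pow_sub_pow (carlitzFactor l (m + 1))⁻¹ 1 s
  rw [one_pow] at h5
  exact h1.trans h5

theorem X_pow_dvd_gLog_term {li : (CInf Fq)⟦X⟧} (hli0 : constantCoeff li = 0)
    (f : (CInf Fq)⟦X⟧) (m : ℕ) : X ^ m ∣ li ^ (q Fq ^ m) * f :=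
  ((pow_dvd_pow X (lt_q_pow (Fq := Fq) m).le).trans
    (X_pow_dvd_pow_of_constantCoeff_eq_zero hli0 _)).mul_right _

open scoped PowerSeries.WithPiTopology

theorem multipliable_carlitzFactor_inv_pow (hl0 : constantCoeff l = 0) (s : ℕ) :
    Multipliable fun m => (carlitzFactor l (m + 1))⁻¹ ^ s := by
  have h := PowerSeries.WithPiTopology.multipliable_one_add_of_tendsto_order_atTop_nhds_top
    (CInf Fq) (tendsto_order_of_X_pow_dvd (X_pow_dvd_carlitzFactor_inv_pow_sub_one hl0 s))
  simpa using h

theorem summable_gLog_term {li : (CInf Fq)⟦X⟧} (hli0 : constantCoeff li = 0)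
    (f : ℕ → (CInf Fq)⟦X⟧) : Summable fun m => li ^ (q Fq ^ m) * f m :=
  PowerSeries.WithPiTopology.summable_of_tendsto_order_atTop_nhds_top _
    (tendsto_order_of_X_pow_dvd fun m => X_pow_dvd_gLog_term hli0 (f m) m)

theorem expand_carlitzFactor_inv_pow (hl0 : constantCoeff l = 0) {d : ℕ}
    (hl : PowerSeries.map (frob Fq d) l = l) (s m : ℕ) :
    PowerSeries.expand (q Fq ^ d) (q_pow_ne_zero d) ((carlitzFactor l (m + 1))⁻¹ ^ s) =
      (carlitzFactor l (m + d + 1))⁻¹ ^ s := by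
  have hc := constantCoeff_carlitzFactor hl0 (m + 1)
  rw [map_pow, map_powerSeries_inv (PowerSeries.expand (q Fq ^ d) (q_pow_ne_zero d))
    (by rw [hc]; exact one_ne_zero) (by rw [PowerSeries.constantCoeff_expand, hc]; exact one_ne_zero),
    expand_carlitzFactor hl, add_right_comm]

/-- The substitution removes the first d factors of the product. Their inverse is π_d without its
scalar β^(-d), whence the constant β^d. -/
theorem expand_GZero (hl0 : constantCoeff l = 0) {d : ℕ} (hl : PowerSeries.map (frob Fq d) l = l) {β : CInf Fq} (hβ : β ≠ 0)
    (s : ℕ) :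
    PowerSeries.expand (q Fq ^ d) (q_pow_ne_zero d) (GZero l s) =
      PowerSeries.C (β ^ d) * piSeries l β s d * GZero l s := by
  set T : ℕ → (CInf Fq)⟦X⟧ := fun m => (carlitzFactor l (m + 1))⁻¹ ^ s with hT
  have hG : GZero l s = ∏' m, T m := rfl
  have hm : Multipliable T := multipliable_carlitzFactor_inv_pow hl0 s
  have h1 : ∀ m, PowerSeries.expand (q Fq ^ d) (q_pow_ne_zero d) (T m) = T (m + d) :=
    expand_carlitzFactor_inv_pow hl0 hl s
  have h2 : PowerSeries.expand (q Fq ^ d) (q_pow_ne_zero d) (GZero l s) = ∏' m, T (m + d) := by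
    rw [hG, hm.map_tprod _ (continuous_expand _)]
    exact tprod_congr h1
  have hm' : Multipliable fun m => T (m + d) :=
    (hm.map (PowerSeries.expand (R := CInf Fq) (q Fq ^ d) (q_pow_ne_zero d))
      (continuous_expand _)).congr h1
  have h3 : (∏ m ∈ Finset.range d, T m) * ∏' m, T (m + d) = GZero l s :=
    hm'.prod_mul_tprod_nat_mul'
  have h4 : PowerSeries.C (β ^ d) * piSeries l β s d =
      ∏ m ∈ Finset.range d, carlitzFactor l (m + 1) ^ s := by
    rw [piSeries_eq, ← mul_assoc, ← map_mul, ← mul_pow, mul_inv_cancel₀ hβ, one_pow, map_one,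
      one_mul]
  have h5 : (∏ m ∈ Finset.range d, carlitzFactor l (m + 1) ^ s) * ∏ m ∈ Finset.range d, T m =
      1 := by
    rw [← Finset.prod_mul_distrib]
    refine Finset.prod_eq_one fun i _ => ?_
    rw [hT, ← mul_pow, PowerSeries.mul_inv_cancel, one_pow]
    rw [constantCoeff_carlitzFactor hl0]
    exact one_ne_zero
  rw [h2, h4, ← h3, ← mul_assoc, h5, one_mul]

/-- The m-th term becomes π_d times the (m+d)-th term; the first d terms are missing and form the
finite correction. -/
theorem expand_GLog (hl0 : constantCoeff l = 0) {d : ℕ} (hl : PowerSeries.map (frob Fq d) l = l) {β : CInf Fq} (hβ : β ≠ 0)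
    (s : ℕ) {li : (CInf Fq)⟦X⟧} (hli0 : constantCoeff li = 0)
    (hli : PowerSeries.map (frob Fq d) li = li) :
    PowerSeries.expand (q Fq ^ d) (q_pow_ne_zero d) (GLog l li β s) =
      piSeries l β s d * GLog l li β s + -(piSeries l β s d *
        ∑ m ∈ Finset.range d, li ^ (q Fq ^ m) * (piSeries l β s m)⁻¹) := by
  have hm := summable_gLog_term hli0 fun m => (piSeries l β s m)⁻¹
  have hc := constantCoeff_piSeries_ne_zero hl0 hβ s
  have h1 : ∀ m, PowerSeries.expand (q Fq ^ d) (q_pow_ne_zero d)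
      (li ^ (q Fq ^ m) * (piSeries l β s m)⁻¹) =
      piSeries l β s d * (li ^ (q Fq ^ (m + d)) * (piSeries l β s (m + d))⁻¹) := by
    intro m
    have hinv : PowerSeries.expand (q Fq ^ d) (q_pow_ne_zero d) (piSeries l β s m)⁻¹ =
        piSeries l β s d * (piSeries l β s (m + d))⁻¹ := by
      rw [PowerSeries.eq_mul_inv_iff_mul_eq (hc _), ← expand_piSeries_mul hl, ← mul_assoc,
        ← map_mul, PowerSeries.inv_mul_cancel _ (hc m), map_one, one_mul]
    rw [map_mul, map_pow, expand_eq_pow_of_map_frob hli, hinv, ← pow_mul, ← pow_add, add_comm d m]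
    ring
  have h2 := hm.map_tsum (PowerSeries.expand (R := CInf Fq) (q Fq ^ d) (q_pow_ne_zero d))
    (continuous_expand _)
  have hm' : Summable fun m => li ^ (q Fq ^ (m + d)) * (piSeries l β s (m + d))⁻¹ :=
    (summable_nat_add_iff d).2 hm
  have h3 := hm.sum_add_tsum_nat_add d
  have hG : GLog l li β s = ∑' m, li ^ (q Fq ^ m) * (piSeries l β s m)⁻¹ := rfl
  rw [← hG] at h2 h3
  rw [h2, tsum_congr h1, hm'.tsum_mul_left, ← h3]
  ring

/-! ### Coefficients of G₀ and Gᵢ in a subfield of ℂ_∞. -/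

variable (F : Subfield (CInf Fq))

theorem carlitzFactor_mem (hθ : theta Fq ∈ F)
    (hlF : l ∈ (PowerSeries.map F.subtype).range) (i : ℕ) : carlitzFactor l i ∈ (PowerSeries.map F.subtype).range :=
  sub_mem (one_mem _) (mul_mem (C_mem_range_map_subtype F hθ) (pow_mem hlF _))

theorem piSeries_mem (hθ : theta Fq ∈ F)
    (hlF : l ∈ (PowerSeries.map F.subtype).range) {β : CInf Fq} (hβ : β ∈ F) (s m : ℕ) :
    piSeries l β s m ∈ (PowerSeries.map F.subtype).range := by
  rw [piSeries_eq]
  exact mul_mem (C_mem_range_map_subtype F (pow_mem (inv_mem hβ) m))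
    (prod_mem fun i _ => pow_mem (carlitzFactor_mem F hθ hlF _) s)

theorem GZero_mem (hl0 : constantCoeff l = 0) (hθ : theta Fq ∈ F)
    (hlF : l ∈ (PowerSeries.map F.subtype).range) (s : ℕ) : GZero l s ∈ (PowerSeries.map F.subtype).range := by
  refine mem_range_map_subtype_of_tendsto F (f := fun N => ∏ m ∈ Finset.range N,
    (carlitzFactor l (m + 1))⁻¹ ^ s) (fun N => ?_) (fun N => ?_)
    (multipliable_carlitzFactor_inv_pow hl0 s).hasProd.tendsto_prod_nat
  · refine prod_mem fun i _ => pow_mem (inv_mem_range_map_subtype F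
      (carlitzFactor_mem F hθ hlF _) ?_) s
    simp [constantCoeff_carlitzFactor hl0]
  · rw [Finset.prod_range_succ, ← mul_sub_one]
    exact (X_pow_dvd_carlitzFactor_inv_pow_sub_one hl0 s N).mul_left _

theorem GLog_mem (hl0 : constantCoeff l = 0) (hθ : theta Fq ∈ F)
    (hlF : l ∈ (PowerSeries.map F.subtype).range) {β : CInf Fq} (hβ0 : β ≠ 0) (hβ : β ∈ F) (s : ℕ) {li : (CInf Fq)⟦X⟧}
    (hli0 : constantCoeff li = 0) (hliF : li ∈ (PowerSeries.map F.subtype).range) :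
    GLog l li β s ∈ (PowerSeries.map F.subtype).range := by
  refine mem_range_map_subtype_of_tendsto F (f := fun N => ∑ m ∈ Finset.range N,
    li ^ (q Fq ^ m) * (piSeries l β s m)⁻¹) (fun N => ?_) (fun N => ?_)
    (summable_gLog_term hli0 _).hasSum.tendsto_sum_nat
  · exact sum_mem fun i _ => mul_mem (pow_mem hliF _) (inv_mem_range_map_subtype F
      (piSeries_mem F hθ hlF hβ s _) (constantCoeff_piSeries_ne_zero hl0 hβ0 s _))
  · rw [Finset.sum_range_succ, add_sub_cancel_left]
    exact X_pow_dvd_gLog_term hli0 _ N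

end FunctionalEquations

end CarlitzMahler

namespace CarlitzMahler

/-! ### The Mahler operator on Laurent series -/

section Laurent

variable {L : Type*} [Field L]

/-- The Laurent series with coefficients in a subfield. -/
noncomputable def laurentSubfield (F : Subfield L) : Subfield L⸨X⸩ :=
  ({ toFun := fun x : F⸨X⸩ => x.map F.subtype
     map_zero' := by ext; simp
     map_one' := HahnSeries.map_one (F.subtype.toMonoidWithZeroHom)
     map_add' := fun x y => by ext; simp
     map_mul' := fun x y => HahnSeries.map_mul (F.subtype : F →ₙ+* L) } :
    F⸨X⸩ →+* L⸨X⸩).fieldRange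

theorem mem_laurentSubfield_iff {F : Subfield L} {f : L⸨X⸩} :
    f ∈ laurentSubfield F ↔ ∀ j, f.coeff j ∈ F := by
  constructor
  · rintro ⟨g, rfl⟩ j
    exact (g.coeff j).2
  · intro h
    exact ⟨⟨fun j => ⟨f.coeff j, h j⟩, f.isPWO_support.mono fun j hj h0 => hj (Subtype.ext h0)⟩, rfl⟩

theorem coeff_ofPowerSeries_of_neg (f : L⟦X⟧) {j : ℤ} (hj : j < 0) :
    (HahnSeries.ofPowerSeries ℤ L f).coeff j = 0 := by
  rw [HahnSeries.ofPowerSeries_apply]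
  refine HahnSeries.embDomain_of_notMem_range ?_
  rintro ⟨n, rfl⟩
  simp at hj
  lia

theorem ofPowerSeries_mem_laurentSubfield {F : Subfield L} {f : L⟦X⟧}
    (hf : f ∈ (PowerSeries.map F.subtype).range) :
    HahnSeries.ofPowerSeries ℤ L f ∈ laurentSubfield F := by
  rw [mem_laurentSubfield_iff]
  intro j
  rcases lt_or_ge j 0 with hj | hj
  · rw [coeff_ofPowerSeries_of_neg f hj]
    exact zero_mem _
  · obtain ⟨n, rfl⟩ := Int.eq_ofNat_of_zero_le hj
    rw [HahnSeries.ofPowerSeries_apply_coeff]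
    exact (mem_range_map_subtype_iff F).1 hf n

theorem C_mem_laurentSubfield {F : Subfield L} {c : L} (hc : c ∈ F) :
    (HahnSeries.C c : L⸨X⸩) ∈ laurentSubfield F := by
  rw [← HahnSeries.ofPowerSeries_C]
  exact ofPowerSeries_mem_laurentSubfield (C_mem_range_map_subtype F hc)

/-- The operator `f(Z) ↦ f(Z^N)` on Laurent series. -/
noncomputable def mahler (L : Type*) [Field L] (N : ℕ) (hN : N ≠ 0) : L⸨X⸩ →+* L⸨X⸩ :=
  HahnSeries.embDomainRingHom (AddMonoidHom.mulLeft (N : ℤ))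
    (mul_right_injective₀ (by exact_mod_cast hN))
    fun _ _ => mul_le_mul_iff_right₀ (by exact_mod_cast Nat.pos_of_ne_zero hN)

variable {N : ℕ} (hN : N ≠ 0)

theorem coeff_mahler_mul (f : L⸨X⸩) (j : ℤ) : (mahler L N hN f).coeff (N * j) = f.coeff j :=
  HahnSeries.embDomain_coeff (a := j)

theorem coeff_mahler_of_not_dvd (f : L⸨X⸩) {j : ℤ} (hj : ¬ (N : ℤ) ∣ j) :
    (mahler L N hN f).coeff j = 0 := by
  refine HahnSeries.embDomain_of_notMem_range ?_
  rintro ⟨i, rfl⟩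
  exact hj ⟨i, rfl⟩

theorem mahler_C (c : L) : mahler L N hN (HahnSeries.C c) = HahnSeries.C c :=
  HahnSeries.embDomainRingHom_C

theorem mahler_ofPowerSeries (f : L⟦X⟧) :
    mahler L N hN (HahnSeries.ofPowerSeries ℤ L f) =
      HahnSeries.ofPowerSeries ℤ L (PowerSeries.expand N hN f) := by
  ext j
  have hN' : (0 : ℤ) < N := by exact_mod_cast Nat.pos_of_ne_zero hN
  by_cases hj : (N : ℤ) ∣ j
  · obtain ⟨i, rfl⟩ := hj
    rw [coeff_mahler_mul]
    rcases lt_or_ge i 0 with hi | hi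
    · rw [coeff_ofPowerSeries_of_neg _ hi,
        coeff_ofPowerSeries_of_neg _ (mul_neg_of_pos_of_neg hN' hi)]
    · obtain ⟨n, rfl⟩ := Int.eq_ofNat_of_zero_le hi
      rw [HahnSeries.ofPowerSeries_apply_coeff, ← Nat.cast_mul,
        HahnSeries.ofPowerSeries_apply_coeff, PowerSeries.coeff_expand_mul]
  · rw [coeff_mahler_of_not_dvd hN _ hj]
    rcases lt_or_ge j 0 with hi | hi
    · rw [coeff_ofPowerSeries_of_neg _ hi]
    · obtain ⟨n, rfl⟩ := Int.eq_ofNat_of_zero_le hi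
      rw [HahnSeries.ofPowerSeries_apply_coeff, PowerSeries.coeff_expand_of_not_dvd]
      exact fun h => hj (by exact_mod_cast h)

/-- Eigenvectors of the Mahler operator with constant eigenvalue are constant. -/
theorem eq_C_of_mahler_eq (hN2 : 1 < N) {κ : L} {g : L⸨X⸩}
    (h : mahler L N hN g = HahnSeries.C κ * g) : g = HahnSeries.C (g.coeff 0) := by
  by_cases hκ : κ = 0
  · have : g = 0 := by
      rw [hκ, map_zero, zero_mul, map_eq_zero] at h
      exact h
    simp [this]
  -- The coefficient of g(Z^N) at j ≠ 0 is 0 or the coefficient of g at j/N, and |j/N| < |j|: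
  -- descent on |j|.
  have key : ∀ m : ℕ, ∀ j : ℤ, j.natAbs = m → j ≠ 0 → g.coeff j = 0 := by
    intro m
    induction m using Nat.strong_induction_on with
    | _ m ih =>
    intro j hjm hj
    have h1 := congrArg (fun f : L⸨X⸩ => f.coeff j) h
    simp only [HahnSeries.C_mul_eq_smul, HahnSeries.coeff_smul, smul_eq_mul] at h1
    refine (mul_eq_zero.1 ?_).resolve_left hκ
    rw [← h1]
    by_cases hdvd : (N : ℤ) ∣ j
    · obtain ⟨i, rfl⟩ := hdvd
      rw [coeff_mahler_mul]
      have hi : i ≠ 0 := by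
        rintro rfl
        simp at hj
      refine ih i.natAbs ?_ i rfl hi
      rw [← hjm, Int.natAbs_mul, Int.natAbs_natCast]
      exact lt_mul_of_one_lt_left (Int.natAbs_pos.2 hi) hN2
    · exact coeff_mahler_of_not_dvd _ g hdvd
  ext j
  rw [HahnSeries.C_apply]
  by_cases hj : j = 0
  · simp [hj]
  · rw [key _ j rfl hj, HahnSeries.coeff_single_of_ne hj]

end Laurent

/-! ### The field of constants -/

section Constants

variable {Fq : Type*} [Field Fq] [Finite Fq]

theorem theta_mem_kBar : theta Fq ∈ kBar Fq :=
  (kBar Fq).algebraMap_mem ⟨theta Fq, IntermediateField.mem_adjoin_simple_self Fq _⟩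

theorem fqBar_le_kBar {c : CInf Fq} (hc : c ∈ FqBar Fq) : c ∈ kBar Fq := by
  rw [mem_algebraicClosure_iff] at hc ⊢
  exact hc.tower_top _

theorem fqBarThetaBeta_le_kBar {β : CInf Fq} (hβ : β ∈ kBar Fq) {c : CInf Fq}
    (hc : c ∈ FqBarThetaBeta Fq β) : c ∈ kBar Fq := by
  let A : IntermediateField (FqBar Fq) (CInf Fq) :=
    (kBar Fq).toSubfield.toIntermediateField fun x => fqBar_le_kBar x.2
  have hle : FqBarThetaBeta Fq β ≤ A := by
    rw [IntermediateField.adjoin_le_iff]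
    rintro x (rfl | rfl)
    · exact theta_mem_kBar
    · exact hβ
  exact hle hc

theorem B_le_kBar {β : CInf Fq} (hβ : β ∈ kBar Fq) {c : CInf Fq} (hc : c ∈ B Fq β) :
    c ∈ kBar Fq := by
  obtain ⟨n, y, hy⟩ := mem_perfectClosure_iff.1 hc
  rw [mem_algebraicClosure_iff]
  refine IsAlgebraic.of_pow (n := ringExpChar (FqBarThetaBeta Fq β) ^ n)
    (pow_pos (expChar_pos (FqBarThetaBeta Fq β) _) n) ?_
  rw [← hy]
  exact mem_algebraicClosure_iff.1 (fqBarThetaBeta_le_kBar hβ y.2)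

theorem fqBarThetaBeta_le_B {β c : CInf Fq} (hc : c ∈ FqBarThetaBeta Fq β) : c ∈ B Fq β :=
  (B Fq β).algebraMap_mem ⟨c, hc⟩

theorem fqBar_le_B {β c : CInf Fq} (hc : c ∈ FqBar Fq) : c ∈ B Fq β :=
  fqBarThetaBeta_le_B ((FqBarThetaBeta Fq β).algebraMap_mem ⟨c, hc⟩)

theorem theta_mem_B (β : CInf Fq) : theta Fq ∈ B Fq β :=
  fqBarThetaBeta_le_B (IntermediateField.subset_adjoin _ _ (by simp))

theorem self_mem_B (β : CInf Fq) : β ∈ B Fq β :=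
  fqBarThetaBeta_le_B (IntermediateField.subset_adjoin _ _ (by simp))

theorem k_le_B {β c : CInf Fq} (hc : c ∈ k Fq) : c ∈ B Fq β := by
  let A : IntermediateField Fq (CInf Fq) :=
    (B Fq β).toSubfield.toIntermediateField fun x => fqBar_le_B ((FqBar Fq).algebraMap_mem x)
  have hle : k Fq ≤ A := by
    rw [IntermediateField.adjoin_simple_le_iff]
    exact theta_mem_B β
  exact hle hc

theorem mem_fqBar_of_frob_fixed {d : ℕ} (hd : 1 ≤ d) {c : CInf Fq} (hc : c ^ (q Fq ^ d) = c) :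
    c ∈ FqBar Fq := by
  have h2 : 1 < q Fq ^ d := Nat.one_lt_pow (by lia) (Finite.one_lt_card (α := Fq))
  rw [mem_algebraicClosure_iff]
  refine ⟨Polynomial.X ^ (q Fq ^ d) - Polynomial.X, ?_, by simp [hc]⟩
  exact FiniteField.X_pow_card_sub_X_ne_zero Fq h2

/-- The elements of `k̄` come from the algebraic closure of `k_∞`. -/
theorem mem_range_coe_of_mem_kBar {c : CInf Fq} (hc : c ∈ kBar Fq) :
    c ∈ (algebraMap (AlgebraicClosure (KInf Fq)) (CInf Fq)).range := by
  let R := (algebraMap (AlgebraicClosure (KInf Fq)) (CInf Fq)).fieldRange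
  let A : IntermediateField Fq (CInf Fq) := R.toIntermediateField fun x =>
    ⟨algebraMap Fq (AlgebraicClosure (KInf Fq)) x, rfl⟩
  have hle : k Fq ≤ A := by
    rw [IntermediateField.adjoin_simple_le_iff]
    exact ⟨_, rfl⟩
  rw [mem_algebraicClosure_iff] at hc
  obtain ⟨P, hP0, hP⟩ := hc
  have hlift : P.map (algebraMap (k Fq) (CInf Fq)) ∈
      Polynomial.lifts (algebraMap (AlgebraicClosure (KInf Fq)) (CInf Fq)) := by
    rw [Polynomial.lifts_iff_coeff_lifts]
    intro j
    rw [Polynomial.coeff_map]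
    exact hle (P.coeff j).2
  obtain ⟨P', hP'⟩ := (Polynomial.mem_lifts _).1 hlift
  have halg : IsAlgebraic (AlgebraicClosure (KInf Fq)) c := by
    refine ⟨P', ?_, ?_⟩
    · rintro rfl
      rw [Polynomial.map_zero, eq_comm, Polynomial.map_eq_zero] at hP'
      exact hP0 hP'
    · rw [Polynomial.aeval_def, ← Polynomial.eval_map, hP', Polynomial.eval_map,
        ← Polynomial.aeval_def, hP]
  exact minpoly.mem_range_of_degree_eq_one _ _ (IsAlgClosed.degree_eq_one_of_irreducible _
    (minpoly.irreducible halg.isIntegral))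

/-- As c is algebraic over k, a p-th root already exists in the algebraic closure of k_∞; it remains
purely inseparable over 𝔽̄_q(θ, β), with exponent n + 1 in place of n. -/
theorem exists_pow_eq_of_mem_B {p : ℕ} (hp : p.Prime) [CharP Fq p] {β c : CInf Fq}
    (hβ : β ∈ kBar Fq) (hc : c ∈ B Fq β) : ∃ γ ∈ B Fq β, γ ^ p = c := by
  obtain ⟨x, rfl⟩ := mem_range_coe_of_mem_kBar (B_le_kBar hβ hc)
  obtain ⟨y, rfl⟩ := IsAlgClosed.exists_pow_nat_eq x hp.pos
  refine ⟨algebraMap _ _ y, ?_, (map_pow _ _ _).symm⟩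
  have := charP_of_injective_algebraMap (algebraMap Fq (FqBarThetaBeta Fq β)).injective p
  have : ExpChar (FqBarThetaBeta Fq β) p := ExpChar.prime hp
  have hring : ringExpChar (FqBarThetaBeta Fq β) = p := ringExpChar.eq _ p
  rw [mem_perfectClosure_iff, hring] at hc ⊢
  obtain ⟨n, hn⟩ := hc
  refine ⟨n + 1, ?_⟩
  rwa [map_pow, ← pow_mul, ← pow_succ'] at hn

end Constants

/-! ### The difference field of algebraic Laurent series -/

section MahlerExtension

variable {Fq : Type*} [Field Fq] [Finite Fq]

theorem k_le_laurentSubfield (β : CInf Fq) (c : k Fq) :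
    algebraMap (k Fq) (CInf Fq)⸨X⸩ c ∈ laurentSubfield (B Fq β).toSubfield := by
  rw [algebraMap_k_laurentSeries]
  exact C_mem_laurentSubfield (k_le_B c.2)

theorem single_one_mem_laurentSubfield (F : Subfield (CInf Fq)) :
    HahnSeries.single (1 : ℤ) (1 : CInf Fq) ∈ laurentSubfield F := by
  rw [← HahnSeries.ofPowerSeries_X]
  exact ofPowerSeries_mem_laurentSubfield ⟨PowerSeries.X, by simp⟩

theorem kZ_le_laurentSubfield (β : CInf Fq) {x : (CInf Fq)⸨X⸩} (hx : x ∈ kZ Fq) :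
    x ∈ laurentSubfield (B Fq β).toSubfield := by
  have hle : kZ Fq ≤ (laurentSubfield (B Fq β).toSubfield).toIntermediateField
      (k_le_laurentSubfield β) := by
    rw [IntermediateField.adjoin_simple_le_iff]
    exact single_one_mem_laurentSubfield _
  exact hle hx

/-- The Laurent series with coefficients in `𝐁` that are algebraic over `k(Z)`. -/
noncomputable def algLaurent (β : CInf Fq) : IntermediateField (kZ Fq) (CInf Fq)⸨X⸩ :=
  algebraicClosure (kZ Fq) (CInf Fq)⸨X⸩ ⊓
    (laurentSubfield (B Fq β).toSubfield).toIntermediateField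
      fun x => kZ_le_laurentSubfield β x.2

theorem mem_algLaurent_iff {β : CInf Fq} {x : (CInf Fq)⸨X⸩} :
    x ∈ algLaurent β ↔ IsAlgebraic (kZ Fq) x ∧ x ∈ laurentSubfield (B Fq β).toSubfield := by
  rw [algLaurent, IntermediateField.mem_inf, mem_algebraicClosure_iff]
  rfl

theorem isAlgebraic_C {c : CInf Fq} (hc : c ∈ kBar Fq) :
    IsAlgebraic (kZ Fq) (HahnSeries.C c : (CInf Fq)⸨X⸩) := by
  rw [mem_algebraicClosure_iff] at hc
  refine hc.ringHom_of_comp_eq (algebraMap (k Fq) (kZ Fq))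
    (HahnSeries.C : CInf Fq →+* (CInf Fq)⸨X⸩) (algebraMap (k Fq) (kZ Fq)).injective ?_
  ext1 c
  exact algebraMap_k_laurentSeries c

theorem C_mem_algLaurent {β c : CInf Fq} (hβ : β ∈ kBar Fq) (hc : c ∈ B Fq β) :
    (HahnSeries.C c : (CInf Fq)⸨X⸩) ∈ algLaurent β :=
  mem_algLaurent_iff.2 ⟨isAlgebraic_C (B_le_kBar hβ hc), C_mem_laurentSubfield hc⟩

theorem mahler_mem_laurentSubfield {N : ℕ} (hN : N ≠ 0) {F : Subfield (CInf Fq)}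
    {x : (CInf Fq)⸨X⸩} (hx : x ∈ laurentSubfield F) :
    mahler (CInf Fq) N hN x ∈ laurentSubfield F := by
  rw [mem_laurentSubfield_iff] at hx ⊢
  intro j
  by_cases hj : (N : ℤ) ∣ j
  · obtain ⟨i, rfl⟩ := hj
    rw [coeff_mahler_mul]
    exact hx i
  · rw [coeff_mahler_of_not_dvd hN x hj]
    exact zero_mem _

theorem mahler_mem_kZ {N : ℕ} (hN : N ≠ 0) {x : (CInf Fq)⸨X⸩} (hx : x ∈ kZ Fq) :
    mahler (CInf Fq) N hN x ∈ kZ Fq := by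
  let A : IntermediateField (k Fq) (CInf Fq)⸨X⸩ :=
    ((kZ Fq).toSubfield.comap (mahler (CInf Fq) N hN)).toIntermediateField fun c => by
      rw [Subfield.mem_comap, algebraMap_k_laurentSeries, mahler_C, ← algebraMap_k_laurentSeries]
      exact (kZ Fq).algebraMap_mem c
  have hle : kZ Fq ≤ A := by
    rw [IntermediateField.adjoin_simple_le_iff]
    change mahler (CInf Fq) N hN (HahnSeries.single 1 1) ∈ kZ Fq
    rw [← HahnSeries.ofPowerSeries_X, mahler_ofPowerSeries, PowerSeries.expand_X, map_pow,
      HahnSeries.ofPowerSeries_X]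
    exact pow_mem (IntermediateField.mem_adjoin_simple_self _ _) N
  exact hle hx

theorem mahler_mem_algLaurent {N : ℕ} (hN : N ≠ 0) {β : CInf Fq} {x : (CInf Fq)⸨X⸩}
    (hx : x ∈ algLaurent β) : mahler (CInf Fq) N hN x ∈ algLaurent β := by
  rw [mem_algLaurent_iff] at hx ⊢
  refine ⟨?_, mahler_mem_laurentSubfield hN hx.2⟩
  let f : kZ Fq →+* kZ Fq := ((mahler (CInf Fq) N hN).comp
    (algebraMap (kZ Fq) (CInf Fq)⸨X⸩)).codRestrict (kZ Fq) fun x => mahler_mem_kZ hN x.2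
  exact hx.1.ringHom_of_comp_eq f (mahler (CInf Fq) N hN) f.injective rfl

/-- The Mahler operator on Laurent series, with constants `𝐁`. -/
noncomputable def mahlerExtension {p : ℕ} (hp : p.Prime) [CharP Fq p] {β : CInf Fq}
    (hβ : β ∈ kBar Fq) {N : ℕ} (hN : 1 < N) :
    DifferenceExtension (algLaurent β) (CInf Fq)⸨X⸩ p where
  σE := ((mahler (CInf Fq) N (by lia)).comp
    (algebraMap (algLaurent β) (CInf Fq)⸨X⸩)).codRestrict (algLaurent β)
      fun x => mahler_mem_algLaurent (by lia) x.2
  σ := mahler (CInf Fq) N (by lia)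
  M := laurentSubfield (B Fq β).toSubfield
  const := (B Fq β).toSubfield.map HahnSeries.C
  map_algebraMap _ := rfl
  algebraMap_mem x := (mem_algLaurent_iff.1 x.2).2
  isAlgebraic := by
    rintro _ ⟨c, hc, rfl⟩
    exact isAlgebraic_algebraMap (⟨_, C_mem_algLaurent hβ hc⟩ : algLaurent β)
  const_of_eigenvector := by
    rintro _ ⟨κ, -, rfl⟩ g hg h
    exact ⟨g.coeff 0, mem_laurentSubfield_iff.1 hg 0, (eq_C_of_mahler_eq _ hN h).symm⟩
  perfect := by
    rintro _ ⟨c, hc, rfl⟩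
    obtain ⟨γ, hγ, rfl⟩ := exists_pow_eq_of_mem_B hp hβ hc
    exact ⟨_, ⟨γ, hγ, rfl⟩, (map_pow _ _ _).symm⟩

theorem expansion_mem_range {d : ℕ} (hd : 1 ≤ d) {u x β : CInf Fq} {f : (CInf Fq)⟦X⟧}
    (hf : IsExpansion d u f x) : f ∈ (PowerSeries.map (B Fq β).toSubfield.subtype).range :=
  (mem_range_map_subtype_iff _).2 fun j => fqBar_le_B (mem_fqBar_of_frob_fixed hd (hf.1 j))

theorem piSeries_mem_algLaurent {l : (CInf Fq)⟦X⟧} {β : CInf Fq} (hβ : β ∈ kBar Fq) (s m : ℕ)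
    (hl : HahnSeries.ofPowerSeries ℤ (CInf Fq) l ∈ algLaurent β) :
    HahnSeries.ofPowerSeries ℤ (CInf Fq) (piSeries l β s m) ∈ algLaurent β := by
  rw [piSeries, map_mul, map_prod, HahnSeries.ofPowerSeries_C]
  refine mul_mem (C_mem_algLaurent hβ (pow_mem (inv_mem (self_mem_B β)) m))
    (prod_mem fun i _ => ?_)
  rw [map_pow, map_sub, map_one, map_mul, map_pow, HahnSeries.ofPowerSeries_C]
  exact pow_mem (sub_mem (one_mem _)
    (mul_mem (C_mem_algLaurent hβ (theta_mem_B β)) (pow_mem hl _))) s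

end MahlerExtension

/-! ### The size of θθ̃ and the bound on the uᵢ. -/

section NormBounds

variable {Fq : Type*} [Field Fq] [Finite Fq]

theorem norm_one_div_theta_lt_one : ‖1 / theta Fq‖ < 1 := by
  rw [norm_div, norm_one, norm_theta]
  have h : (1 : ℝ) < q Fq := by exact_mod_cast Finite.one_lt_card (α := Fq)
  exact (div_lt_one (one_pos.trans h)).2 h

/-- The exponent is 1 + 1/(q-1) = q/(q-1). The hypothesis on uᵢ thus says |uᵢ/(θθ̃)| < 1, which
makes 𝐥ᵢ(0) = 0 and the series Gᵢ convergent. -/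
theorem norm_theta_mul {θt : CInf Fq} (hθt : θt ^ (q Fq - 1) = -theta Fq) :
    ‖theta Fq * θt‖ = (q Fq : ℝ) ^ ((q Fq : ℝ) / ((q Fq : ℝ) - 1)) := by
  have hq : 1 < q Fq := Finite.one_lt_card (α := Fq)
  have hq' : (1 : ℝ) < q Fq := by exact_mod_cast hq
  have h1 : ‖θt‖ ^ (q Fq - 1) = q Fq := by rw [← norm_pow, hθt, norm_neg, norm_theta]
  have h2 : ‖θt‖ = (q Fq : ℝ) ^ (((q Fq - 1 : ℕ) : ℝ)⁻¹) := by
    rw [← h1, Real.pow_rpow_inv_natCast (norm_nonneg _) (by lia)]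
  rw [norm_mul, norm_theta, h2, Nat.cast_sub hq.le, Nat.cast_one]
  nth_rewrite 1 [← Real.rpow_one (q Fq : ℝ)]
  rw [← Real.rpow_add (one_pos.trans hq')]
  congr 1
  have : (q Fq : ℝ) - 1 ≠ 0 := (sub_pos.2 hq').ne'
  field_simp
  ring

theorem norm_div_theta_mul_lt_one {θt w : CInf Fq} (hθt : θt ^ (q Fq - 1) = -theta Fq)
    (hw : ‖w‖ < (q Fq : ℝ) ^ ((q Fq : ℝ) / ((q Fq : ℝ) - 1))) :
    ‖w / (theta Fq * θt)‖ < 1 := by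
  rw [norm_div, norm_theta_mul hθt]
  exact (div_lt_one ((norm_nonneg w).trans_lt hw)).2 hw

theorem mem_kBar_of_pow_eq {θt : CInf Fq} (hθt : θt ^ (q Fq - 1) = -theta Fq) :
    θt ∈ kBar Fq := by
  rw [mem_algebraicClosure_iff]
  have hq : 1 < q Fq := Finite.one_lt_card (α := Fq)
  refine IsAlgebraic.of_pow (n := q Fq - 1) (by lia) ?_
  rw [hθt]
  exact (mem_algebraicClosure_iff.1 theta_mem_kBar).neg

end NormBounds

/-! ### The linear relation for the interpolation series. -/

section LinearRelation

variable {Fq : Type*} [Field Fq] [Finite Fq]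

theorem mahler_GZero {l : (CInf Fq)⟦X⟧} (hl0 : PowerSeries.constantCoeff l = 0) {d : ℕ}
    (hl : PowerSeries.map (frob Fq d) l = l) {β : CInf Fq} (hβ : β ≠ 0) (s : ℕ) :
    mahler (CInf Fq) (q Fq ^ d) (q_pow_ne_zero d)
        (HahnSeries.ofPowerSeries ℤ (CInf Fq) (GZero l s)) =
      HahnSeries.C (β ^ d) * HahnSeries.ofPowerSeries ℤ (CInf Fq) (piSeries l β s d) *
        HahnSeries.ofPowerSeries ℤ (CInf Fq) (GZero l s) := by
  rw [mahler_ofPowerSeries, expand_GZero hl0 hl hβ, map_mul, map_mul, HahnSeries.ofPowerSeries_C]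

theorem mahler_GLog {l : (CInf Fq)⟦X⟧} (hl0 : PowerSeries.constantCoeff l = 0) {d : ℕ}
    (hl : PowerSeries.map (frob Fq d) l = l) {β : CInf Fq} (hβ : β ≠ 0) (s : ℕ)
    {li : (CInf Fq)⟦X⟧} (hli0 : PowerSeries.constantCoeff li = 0)
    (hli : PowerSeries.map (frob Fq d) li = li) :
    mahler (CInf Fq) (q Fq ^ d) (q_pow_ne_zero d)
        (HahnSeries.ofPowerSeries ℤ (CInf Fq) (GLog l li β s)) =
      HahnSeries.ofPowerSeries ℤ (CInf Fq) (piSeries l β s d) *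
        HahnSeries.ofPowerSeries ℤ (CInf Fq) (GLog l li β s) +
      HahnSeries.ofPowerSeries ℤ (CInf Fq) (-(piSeries l β s d *
        ∑ m ∈ Finset.range d, li ^ (q Fq ^ m) * (piSeries l β s m)⁻¹)) := by
  rw [mahler_ofPowerSeries, expand_GLog hl0 hl hβ s hli0 hli, map_add, map_mul]

/-- If the series `G₀, …, Gₙ` are algebraically dependent over `k(Z)`, then a nontrivial linear
combination with coefficients in `𝐁` is algebraic. -/
theorem exists_linear_relation_of_dependent {n d : ℕ} (hd : 1 ≤ d) {l : (CInf Fq)⟦X⟧}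
    {li : Fin n → (CInf Fq)⟦X⟧} {β : CInf Fq} {s : ℕ}
    (hl0 : PowerSeries.constantCoeff l = 0) (hli0 : ∀ i, PowerSeries.constantCoeff (li i) = 0)
    (hl : PowerSeries.map (frob Fq d) l = l) (hli : ∀ i, PowerSeries.map (frob Fq d) (li i) = li i)
    (hlF : l ∈ (PowerSeries.map (B Fq β).toSubfield.subtype).range)
    (hliF : ∀ i, li i ∈ (PowerSeries.map (B Fq β).toSubfield.subtype).range)
    (hlE : HahnSeries.ofPowerSeries ℤ (CInf Fq) l ∈ algLaurent β)
    (hliE : ∀ i, HahnSeries.ofPowerSeries ℤ (CInf Fq) (li i) ∈ algLaurent β)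
    (hβ : β ∈ kBar Fq) (hβ0 : β ≠ 0)
    (hdep : ¬ AlgebraicIndependent (kZ Fq) (G l li β s)) :
    ∃ η : Fin (n + 1) → B Fq β, η ≠ 0 ∧
      IsAlgebraic (kZ Fq) (∑ i, HahnSeries.C (η i : CInf Fq) * G l li β s i) := by
  obtain ⟨p, r, hp, hchar, -⟩ := exists_q_eq_prime_pow Fq
  have := Fact.mk hp
  have hN : 1 < q Fq ^ d := Nat.one_lt_pow (by lia) (Finite.one_lt_card (α := Fq))
  have hc := constantCoeff_piSeries_ne_zero hl0 hβ0 s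
  have hpi : ∀ m, HahnSeries.ofPowerSeries ℤ (CInf Fq) (piSeries l β s m) ∈ algLaurent β :=
    fun m => piSeries_mem_algLaurent hβ s m hlE
  have hb : ∀ i, HahnSeries.ofPowerSeries ℤ (CInf Fq) (-(piSeries l β s d *
      ∑ m ∈ Finset.range d, li i ^ (q Fq ^ m) * (piSeries l β s m)⁻¹)) ∈ algLaurent β := by
    intro i
    rw [map_neg, map_mul, map_sum]
    refine neg_mem (mul_mem (hpi d) (sum_mem fun m _ => ?_))
    rw [map_mul, map_pow, ofPowerSeries_inv (hc m)]
    exact mul_mem (pow_mem (hliE i) _) (inv_mem (hpi m))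
  have : CharP (CInf Fq) p := charP_of_injective_algebraMap (algebraMap Fq (CInf Fq)).injective p
  have : CharP (CInf Fq)⸨X⸩ p :=
    charP_of_injective_ringHom (HahnSeries.C : CInf Fq →+* (CInf Fq)⸨X⸩).injective p
  have : CharP (algLaurent β) p :=
    (algebraMap (algLaurent β) (CInf Fq)⸨X⸩).charP
      (algebraMap (algLaurent β) (CInf Fq)⸨X⸩).injective p
  have hpow : β ^ d ∈ B Fq β := pow_mem (self_mem_B β) d
  have hM : ∀ {f : PowerSeries (CInf Fq)},
      f ∈ (PowerSeries.map (B Fq β).toSubfield.subtype).range →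
      HahnSeries.ofPowerSeries ℤ (CInf Fq) f ∈ (mahlerExtension hp hβ hN).M :=
    fun h => ofPowerSeries_mem_laurentSubfield h
  obtain ⟨c, hcC, hc0, halg⟩ := (mahlerExtension hp hβ hN).exists_linear_relation
    (κ := ⟨HahnSeries.C (β ^ d), C_mem_algLaurent hβ hpow⟩)
    (a := ⟨HahnSeries.ofPowerSeries ℤ (CInf Fq) (piSeries l β s d), hpi d⟩)
    (b := fun i => ⟨_, hb i⟩)
    (G₀ := HahnSeries.ofPowerSeries ℤ (CInf Fq) (GZero l s))
    (G := fun i => HahnSeries.ofPowerSeries ℤ (CInf Fq) (GLog l (li i) β s))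
    ⟨β ^ d, hpow, rfl⟩
    (by
      rw [Ne, ← ZeroMemClass.coe_eq_zero]
      change HahnSeries.ofPowerSeries ℤ (CInf Fq) (piSeries l β s d) ≠ 0
      rw [Ne, map_eq_zero_iff _ HahnSeries.ofPowerSeries_injective]
      intro h
      exact hc d (by rw [h, map_zero]))
    (hM (GZero_mem _ hl0 (theta_mem_B β) hlF s))
    (fun i => hM (GLog_mem _ hl0 (theta_mem_B β) hlF hβ0 (self_mem_B β) s
      (hli0 i) (hliF i)))
    (mahler_GZero hl0 hl hβ0 s)
    (fun i => mahler_GLog hl0 hl hβ0 s (hli0 i) (hli i))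
    -- Independence over the larger field E would imply independence over k(Z).
    (fun h => hdep (h.restrictScalars (algebraMap (kZ Fq) (algLaurent β)).injective))
  have hcC' : ∀ i, ∃ b ∈ B Fq β, (HahnSeries.C b : (CInf Fq)⸨X⸩) = c i := hcC
  choose η hη hηc using hcC'
  refine ⟨fun i => ⟨η i, hη i⟩, ?_, ?_⟩
  · intro h
    refine hc0 (funext fun i => ?_)
    have hi : η i = 0 := congrArg Subtype.val (congrFun h i)
    rw [← hηc i, hi, map_zero]
    rfl
  -- E is algebraic over k(Z), so algebraicity over E descends to k(Z).
  · have : Algebra.IsAlgebraic (kZ Fq) (algLaurent β) := ⟨fun x =>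
      (isAlgebraic_algHom_iff (algLaurent β).val (algLaurent β).val.injective).1
        (mem_algLaurent_iff.1 x.2).1⟩
    have h1 := halg.restrictScalars (kZ Fq)
    simp only [← hηc] at h1
    exact h1

end LinearRelation

end CarlitzMahler

/-! ### The main theorem. -/

open CarlitzMahler in
theorem mainTheorem7 (Fq : Type*) [Field Fq] [Finite Fq] (n : ℕ)
    -- `θ̃` is a `(q-1)`-th root of `-θ`
    (θt : CInf Fq) (hθt : θt ^ (q Fq - 1) = -theta Fq)
    -- `u₁, …, uₙ ∈ k̄` with `v_∞(uᵢ) > -q/(q-1)`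
    (w : Fin n → CInf Fq) (hw : ∀ i, w i ∈ kBar Fq)
    (hw' : ∀ i, ‖w i‖ < (q Fq : ℝ) ^ ((q Fq : ℝ) / ((q Fq : ℝ) - 1)))
    -- `u` is a uniformizer of `K = k(θ̃, u₁, …, uₙ)`
    (u : CInf Fq) (hu : IsUniformizer (K θt w) u)
    -- `𝐥, 𝐥ᵢ ∈ 𝔽_{q^d}[[Z]]` with `𝐥(u) = 1/θ` and `𝐥ᵢ(u) = uᵢ/(θθ̃)`
    (d : ℕ) (hd : 1 ≤ d)
    (l : PowerSeries (CInf Fq)) (hl : IsExpansion d u l (1 / theta Fq))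
    (li : Fin n → PowerSeries (CInf Fq))
    (hli : ∀ i, IsExpansion d u (li i) (w i / (theta Fq * θt)))
    (β : CInf Fq) (hβ : β ∈ kBar Fq) (hβ0 : β ≠ 0) (s : ℕ) (hs : 1 ≤ s)
    (hdep : ¬ AlgebraicIndependent (kZ Fq) (G l li β s)) :
    ∃ η : Fin (n + 1) → B Fq β, η ≠ 0 ∧
      IsAlgebraic (kZ Fq) (∑ i, HahnSeries.C (η i : CInf Fq) * G l li β s i) := by
  obtain ⟨huK, hu0, hu1, -⟩ := hu
  have hθtk := mem_kBar_of_pow_eq hθt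
  have huk : u ∈ kBar Fq := by
    have hle : K θt w ≤ kBar Fq := by
      rw [IntermediateField.adjoin_le_iff]
      rintro x (rfl | ⟨i, rfl⟩)
      · exact hθtk
      · exact hw i
    exact hle huK
  have hl0 : PowerSeries.constantCoeff l = 0 := by
    simpa using hl.coeff_zero_eq_zero hd hu1 norm_one_div_theta_lt_one
  have hli0 : ∀ i, PowerSeries.constantCoeff (li i) = 0 := fun i => by
    simpa using (hli i).coeff_zero_eq_zero hd hu1 (norm_div_theta_mul_lt_one hθt (hw' i))
  have hlE : HahnSeries.ofPowerSeries ℤ (CInf Fq) l ∈ algLaurent β :=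
    mem_algLaurent_iff.2 ⟨hl.isAlgebraic hd hu0 hu1 huk (div_mem (one_mem _) theta_mem_kBar),
      ofPowerSeries_mem_laurentSubfield (expansion_mem_range hd hl)⟩
  have hliE : ∀ i, HahnSeries.ofPowerSeries ℤ (CInf Fq) (li i) ∈ algLaurent β := fun i =>
    mem_algLaurent_iff.2 ⟨(hli i).isAlgebraic hd hu0 hu1 huk
      (div_mem (hw i) (mul_mem theta_mem_kBar hθtk)),
      ofPowerSeries_mem_laurentSubfield (expansion_mem_range hd (hli i))⟩
  exact exists_linear_relation_of_dependent hd hl0 hli0 hl.map_frob (fun i => (hli i).map_frob)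
    (expansion_mem_range hd hl) (fun i => expansion_mem_range hd (hli i)) hlE hliE hβ hβ0 hdep
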